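/- Let $G=(V,E)$ be a finite simple graph with a total order $<$ on $V$, and let $\beta\ge 0$, $\gamma>0$, $\lambda>0$ be real numbers. For $\Lambda\subseteq V$ and a pinning $\tau\in\{-,+\}^{V\setminus\Lambda}$, let $\mu^\tau$ be the Gibbs distribution of the 2-spin system on $G$ with pinning $\tau$: it is supported on the $\sigma\in\{-,+\}^V$ with $\sigma_{V\setminus\Lambda}=\tau$, and there $$\mu^\tau(\sigma)\ \propto\ \lambda^{|\{x\in\Lambda:\ \sigma_x=+\}|}\prod_{\substack{\{x,y\}\in E\\ \{x,y\}\cap\Lambda\neq\emptyset}}A(\sigma_x,\sigma_y),\qquad A(+,+)=\beta,\ \ A(-,-)=\gamma,\ \ A(+,-)=A(-,+)=1 .$$ Write $\mu^\tau_S$ for the marginal of $\mu^\tau$ on $S\subseteq V$, write $\tau\wedge v^{c}$ for $\tau$ together with $v$ fixed to $c\in\{-,+\}$, and define the influence $\Psi^\tau_\mu(v,u)=\mu_u^{\tau\wedge v^+}(+)-\mu_u^{\tau\wedge v^-}(+)$. The same definitions apply to pinned 2-spin systems with parameters $\beta,\gamma,\lambda$ on any finite graph. For $v\in\Lambda$,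 the self-avoiding-walk tree $T=T^\tau_{\mathrm{SAW}}(G,v)$ has as nodes the walks $v_0,v_1,\dots,v_\ell$ ($\ell\ge 0$) in $G$ with $v_0=v$ such that $v_0,\dots,v_{\ell-1}$ are distinct and belong to $\Lambda$, and $v_\ell\ne v_{\ell-2}$ if $\ell\ge 2$. Each walk is joined to its one-step extensions, and the root is the walk consisting of $v$ alone. The node $v_0,\dots,v_\ell$ is a copy of the vertex $v_\ell$. Some nodes of $T$ are pinned: if $v_\ell=v_i$ for some $i<\ell$, the node is fixed to $-$ when $v_{i+1}>v_{\ell-1}$ and to $+$ when $v_{i+1}<v_{\ell-1}$; if $v_\ell\notin\Lambda$, the node is fixed to $\tau_{v_\ell}$; all other nodes are free. Let $\Psi^\tau_\pi$ denote the influence for the 2-spin system on $T$ with parameters $\beta,\gamma,\lambda$ and this pinning (the influence on a pinned node is $0$), and identify $v$ with the root of $T$. Then for every $\Lambda\subseteq V$, every $\tau\in\{-,+\}^{V\setminus\Lambda}$ and every $v\in\Lambda$ there is a coupling $(X,Y)$ of $\mu_\Lambda^{\tau\wedge v^-}$ and $\mu_\Lambda^{\tau\wedge v^+}$ such that $$\forall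 u\in\Lambda\setminus\{v\},\qquad \Pr[X_u\neq Y_u]\ \le\ \sum_{\hat u\,:\ \hat u\text{ is a copy of }u\text{ in }T^\tau_{\mathrm{SAW}}(G,v)}\bigl|\Psi^\tau_\pi(v,\hat u)\bigr| .$$ -/

import Mathlib

namespace TwoSpin

/-! Spins are booleans: `true` is the spin `+` and `false` is the spin `-`. -/

/-- The external field: `lam` at spin `+`, and `1` at spin `-`. -/
def field (lam : ℝ) : Bool → ℝ
  | true => lam
  | false => 1

/-- The edge interaction: `β` on `++`, `γ` on `--`, and `1` on two different spins. -/
def interaction (β γ : ℝ) : Bool → Bool → ℝ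
  | true, true => β
  | false, false => γ
  | _, _ => 1

theorem interaction_comm (β γ : ℝ) (a b : Bool) :
    interaction β γ a b = interaction β γ b a := by
  cases a <;> cases b <;> rfl

/-- The interaction along an (unordered) edge under the configuration `σ`. -/
def edgeWeight {V : Type*} (β γ : ℝ) (σ : V → Bool) : Sym2 V → ℝ :=
  Sym2.lift ⟨fun x y => interaction β γ (σ x) (σ y), fun _ _ => interaction_comm β γ _ _⟩

/-- A pinning: `some c` means that the vertex is fixed to the spin `c`, and `none` means that
the vertex is free.  A pair `(Λ, τ)` with `τ ∈ {-,+}^(V ∖ Λ)` is the pinning whose set of free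
vertices is `Λ`. -/
abbrev Pinning (V : Type*) := V → Option Bool

/-- The set `Λ` of free vertices of a pinning. -/
def Pinning.free {V : Type*} (τ : Pinning V) : Set V := {x | τ x = none}

instance Pinning.instDecidableMemFree {V : Type*} (τ : Pinning V) (x : V) :
    Decidable (x ∈ τ.free) :=
  decidable_of_iff ((τ x).isNone = true) Option.isNone_iff_eq_none

/-- The pinning `τ ∧ v^c`. -/
def Pinning.and {V : Type*} [DecidableEq V] (τ : Pinning V) (v : V) (c : Bool) : Pinning V :=
  Function.update τ v (some c)

/-- The configuration `σ` takes the pinned values. -/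
def Pinning.Agrees {V : Type*} (τ : Pinning V) (σ : V → Bool) : Prop :=
  ∀ x c, τ x = some c → σ x = c

open Classical in
/-- The weight `w^τ(σ)`: it vanishes unless `σ` agrees with `τ`; otherwise it is the product of
the fields of the free vertices and of the interactions of the edges that have at least one free
endpoint (the edges between pinned vertices are removed). -/
noncomputable def weight {V : Type*} [Fintype V] [DecidableEq V] (G : SimpleGraph V)
    (β γ lam : ℝ) (τ : Pinning V) (σ : V → Bool) : ℝ :=
  if τ.Agrees σ then
    (∏ x : V with τ x = none, field lam (σ x)) *
      ∏ e : Sym2 V with (e ∈ G.edgeSet ∧ ∃ x ∈ e, τ x = none), edgeWeight β γ σ e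
  else 0

/-- The partition function of the pinned system. -/
noncomputable def partition {V : Type*} [Fintype V] [DecidableEq V] (G : SimpleGraph V)
    (β γ lam : ℝ) (τ : Pinning V) : ℝ :=
  ∑ σ : V → Bool, weight G β γ lam τ σ

/-- The Gibbs distribution `μ^τ` of the 2-spin system with pinning `τ`, as a mass function. -/
noncomputable def gibbs {V : Type*} [Fintype V] [DecidableEq V] (G : SimpleGraph V)
    (β γ lam : ℝ) (τ : Pinning V) (σ : V → Bool) : ℝ :=
  weight G β γ lam τ σ / partition G β γ lam τ

theorem weight_nonneg {V : Type*} [Fintype V] [DecidableEq V] (G : SimpleGraph V)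
    {β γ lam : ℝ} (hβ : 0 ≤ β) (hγ : 0 < γ) (hlam : 0 < lam) (τ : Pinning V) (σ : V → Bool) :
    0 ≤ weight G β γ lam τ σ := by
  unfold weight
  split_ifs
  · refine mul_nonneg (Finset.prod_nonneg fun x _ => ?_) (Finset.prod_nonneg fun e _ => ?_)
    · cases h : σ x <;> simp [field, hlam.le]
    · induction e using Sym2.ind with
      | _ x y =>
        simp only [edgeWeight, Sym2.lift_mk]
        cases σ x <;> cases σ y <;> simp [interaction, hβ, hγ.le]
  · exact le_rfl

/-- The division in `gibbs` is never by zero for the parameters of interest. -/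
theorem partition_pos {V : Type*} [Fintype V] [DecidableEq V] (G : SimpleGraph V)
    {β γ lam : ℝ} (hβ : 0 ≤ β) (hγ : 0 < γ) (hlam : 0 < lam) (τ : Pinning V) :
    0 < partition G β γ lam τ := by
  refine Finset.sum_pos' (fun σ _ => weight_nonneg G hβ hγ hlam τ σ)
    ⟨fun x => (τ x).getD false, Finset.mem_univ _, ?_⟩
  have hag : τ.Agrees (fun x => (τ x).getD false) := by
    intro x c h
    simp [h]
  unfold weight
  rw [if_pos hag]
  refine mul_pos (Finset.prod_pos fun x hx => ?_) (Finset.prod_pos fun e he => ?_)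
  · simp only [Finset.mem_filter] at hx
    simp [hx.2, field]
  · simp only [Finset.mem_filter] at he
    obtain ⟨-, -, z, hz, hzτ⟩ := he
    induction e using Sym2.ind with
    | _ x y =>
      simp only [edgeWeight, Sym2.lift_mk]
      rcases Sym2.mem_iff.1 hz with rfl | rfl
      · simp only [hzτ, Option.getD_none]
        cases (τ y).getD false <;> simp [interaction, hγ]
      · simp only [hzτ, Option.getD_none]
        cases (τ x).getD false <;> simp [interaction, hγ]

open Classical in
/-- The marginal on the set `S` of a mass function `P` on configurations. -/
noncomputable def marginal {V : Type*} [Fintype V] [DecidableEq V] (P : (V → Bool) → ℝ)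
    (S : Set V) (ξ : S → Bool) : ℝ :=
  ∑ σ : V → Bool with (∀ x : S, σ x = ξ x), P σ

/-- The probability that the vertex `u` has spin `+` under `P`. -/
noncomputable def plusProb {V : Type*} [Fintype V] [DecidableEq V] (P : (V → Bool) → ℝ)
    (u : V) : ℝ :=
  ∑ σ : V → Bool with σ u = true, P σ

/-- The influence `Ψ^τ(v, u) = μ^{τ ∧ v^+}_u(+) - μ^{τ ∧ v^-}_u(+)`.  It is zero when `u` is
pinned by `τ` and `u ≠ v`. -/
noncomputable def influence {V : Type*} [Fintype V] [DecidableEq V] (G : SimpleGraph V)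
    (β γ lam : ℝ) (τ : Pinning V) (v u : V) : ℝ :=
  plusProb (gibbs G β γ lam (τ.and v true)) u - plusProb (gibbs G β γ lam (τ.and v false)) u

/-- `J` is (the joint mass function of) a coupling of the mass functions `P` and `Q`. -/
structure IsCoupling {A B : Type*} [Fintype A] [Fintype B] (P : A → ℝ) (Q : B → ℝ)
    (J : A → B → ℝ) : Prop where
  nonneg : ∀ a b, 0 ≤ J a b
  left : ∀ a, ∑ b, J a b = P a
  right : ∀ b, ∑ a, J a b = Q b

/-! ### The self-avoiding-walk tree

A node of the tree is a walk `v₀, v₁, …, v_ℓ` from the root, written as the reversed list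
`[v_ℓ, …, v₁, v₀]`; it is a copy of the vertex `v_ℓ`. -/

/-- The nodes of the self-avoiding-walk tree with pinning `τ`, rooted at (the copy of) `r`.
A node `v₀, …, v_ℓ` has a child for each neighbour of `v_ℓ` other than `v_{ℓ-1}`, unless
`v_ℓ` already occurs among `v₀, …, v_{ℓ-1}` or is pinned by `τ`, in which case it is a leaf. -/
inductive IsSAWNode {V : Type*} (G : SimpleGraph V) (τ : Pinning V) (r : V) : List V → Prop
  | root : IsSAWNode G τ r [r]
  | step {x y : V} {p : List V} (hp : IsSAWNode G τ r (x :: p)) (hx : x ∉ p) (hτ : τ x = none)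
      (hxy : G.Adj x y) (hback : p.head? ≠ some y) : IsSAWNode G τ r (y :: x :: p)

/-- The vertex type of the self-avoiding-walk tree. -/
abbrev SAWNode {V : Type*} (G : SimpleGraph V) (τ : Pinning V) (r : V) :=
  {l : List V // IsSAWNode G τ r l}

theorem IsSAWNode.nodup_tail {V : Type*} {G : SimpleGraph V} {τ : Pinning V} {r : V}
    {l : List V} (h : IsSAWNode G τ r l) : l.tail.Nodup := by
  induction h with
  | root => simp
  | step hp hx hτ hxy hback ih => exact List.nodup_cons.2 ⟨hx, ih⟩

instance SAWNode.instFinite {V : Type*} [Fintype V] (G : SimpleGraph V) (τ : Pinning V) (r : V) :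
    Finite (SAWNode G τ r) := by
  refine Set.Finite.to_subtype
    ((List.finite_length_le V (Fintype.card V + 1)).subset fun l hl => ?_)
  have h := (IsSAWNode.nodup_tail hl).length_le_card
  rw [List.length_tail] at h
  change l.length ≤ _
  omega

noncomputable instance SAWNode.instFintype {V : Type*} [Fintype V] (G : SimpleGraph V)
    (τ : Pinning V) (r : V) : Fintype (SAWNode G τ r) :=
  Fintype.ofFinite _

/-- The self-avoiding-walk tree: a walk is joined to each of its one-step extensions. -/
def sawTree {V : Type*} (G : SimpleGraph V) (τ : Pinning V) (r : V) :
    SimpleGraph (SAWNode G τ r) :=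
  SimpleGraph.fromRel fun a b => ∃ y, b.1 = y :: a.1

/-- The root of the self-avoiding-walk tree. -/
def sawRoot {V : Type*} (G : SimpleGraph V) (τ : Pinning V) (r : V) : SAWNode G τ r :=
  ⟨[r], .root⟩

/-- The node `a` is a copy of the vertex `u`. -/
def IsCopy {V : Type*} {G : SimpleGraph V} {τ : Pinning V} {r : V} (u : V)
    (a : SAWNode G τ r) : Prop :=
  a.1.head? = some u

instance IsCopy.instDecidable {V : Type*} [DecidableEq V] {G : SimpleGraph V} {τ : Pinning V}
    {r : V} (u : V) (a : SAWNode G τ r) : Decidable (IsCopy u a) :=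
  inferInstanceAs (Decidable (a.1.head? = some u))

/-- The spin of a walk `v₀, …, v_{ℓ-1}, x` that closes a cycle at `x = v_i`, where
`p = [v_{ℓ-1}, …, v₀]`.  The initial segment of `p` before `x` is `[v_{ℓ-1}, …, v_{i+1}]`,
and the spin is `+` if `v_{i+1} < v_{ℓ-1}` and `-` if `v_{i+1} > v_{ℓ-1}`. (The first case of the
definition does not occur for walks, and `v_{i+1} = v_{ℓ-1}` does not occur for nodes of the
tree.) -/
def cycleSpin {V : Type*} [LinearOrder V] (x : V) (p : List V) : Bool :=
  match p.takeWhile (fun z => decide (z ≠ x)) with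
  | [] => false
  | y :: c => decide (c.getLastD y < y)

/-- The pinning on the self-avoiding-walk tree: a cycle-closing node is fixed to its cycle spin,
and any other copy of a vertex `x` is pinned exactly as `τ` pins `x`. -/
def sawPinning {V : Type*} [LinearOrder V] (G : SimpleGraph V) (τ : Pinning V) (r : V) :
    Pinning (SAWNode G τ r) := fun a =>
  match a.1 with
  | [] => none
  | x :: p => if x ∈ p then some (cycleSpin x p) else τ x

end TwoSpin

namespace TwoSpin

/-! ### Couplings with a bound on the disagreement probabilities -/

/-- There is a coupling of `P` and `Q` under which the two configurations disagree at `u` with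
probability at most `f u`, for every `u`. -/
def CoupledWithin {V : Type*} [Fintype V] [DecidableEq V] (P Q : (V → Bool) → ℝ)
    (f : V → ℝ) : Prop :=
  ∃ J : (V → Bool) → (V → Bool) → ℝ, IsCoupling P Q J ∧
    ∀ u, ∑ X, ∑ Y with X u ≠ Y u, J X Y ≤ f u

namespace CoupledWithin

variable {V : Type*} [Fintype V] [DecidableEq V] {P Q R P' Q' : (V → Bool) → ℝ} {f g : V → ℝ}

theorem min_one (h : CoupledWithin P Q f) (hP : ∑ σ, P σ = 1) :
    CoupledWithin P Q fun u => min (f u) 1 := by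
  obtain ⟨J, hJ, hf⟩ := h
  refine ⟨J, hJ, fun u => le_min (hf u) ?_⟩
  rw [← hP]
  refine Finset.sum_le_sum fun X _ => ?_
  rw [← hJ.left X]
  exact Finset.sum_le_sum_of_subset_of_nonneg (Finset.filter_subset _ _)
    fun Y _ _ => hJ.nonneg X Y

theorem symm (h : CoupledWithin P Q f) : CoupledWithin Q P f := by
  obtain ⟨J, hJ, hf⟩ := h
  refine ⟨fun X Y => J Y X, ⟨fun a b => hJ.nonneg b a, hJ.right, hJ.left⟩, fun u => ?_⟩
  refine le_trans (le_of_eq ?_) (hf u)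
  simp only [Finset.sum_filter]
  rw [Finset.sum_comm]
  simp only [ne_comm]

theorem smul {c : ℝ} (hc : 0 ≤ c) (h : CoupledWithin P Q f) :
    CoupledWithin (fun σ => c * P σ) (fun σ => c * Q σ) fun u => c * f u := by
  obtain ⟨J, hJ, hf⟩ := h
  refine ⟨fun X Y => c * J X Y, ⟨fun a b => mul_nonneg hc (hJ.nonneg a b), fun a => ?_,
    fun b => ?_⟩, fun u => ?_⟩
  · rw [← Finset.mul_sum, hJ.left]
  · rw [← Finset.mul_sum, hJ.right]
  · simp only [← Finset.mul_sum]
    exact mul_le_mul_of_nonneg_left (hf u) hc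

theorem add (h : CoupledWithin P Q f) (h' : CoupledWithin P' Q' g) :
    CoupledWithin (fun σ => P σ + P' σ) (fun σ => Q σ + Q' σ) fun u => f u + g u := by
  obtain ⟨J, hJ, hf⟩ := h
  obtain ⟨J', hJ', hg⟩ := h'
  refine ⟨fun X Y => J X Y + J' X Y,
    ⟨fun a b => add_nonneg (hJ.nonneg a b) (hJ'.nonneg a b), fun a => ?_, fun b => ?_⟩,
    fun u => ?_⟩
  · rw [Finset.sum_add_distrib, hJ.left, hJ'.left]
  · rw [Finset.sum_add_distrib, hJ.right, hJ'.right]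
  · simp only [Finset.sum_add_distrib]
    exact add_le_add (hf u) (hg u)

/-- The coupling given by a map that transports `P` to `Q` and changes only the spin at `x`. -/
theorem of_map (hP : ∀ σ, 0 ≤ P σ) (φ : (V → Bool) → V → Bool) (x : V)
    (hφ : ∀ σ u, u ≠ x → φ σ u = σ u) (hPQ : ∀ ξ, ∑ σ with φ σ = ξ, P σ = Q ξ)
    (hsum : ∑ σ, P σ = 1) : CoupledWithin P Q fun u => if u = x then 1 else 0 := by
  refine ⟨fun X Y => if φ X = Y then P X else 0, ⟨fun a b => ?_, fun a => ?_, fun b => ?_⟩,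
    fun u => ?_⟩
  · split_ifs
    exacts [hP a, le_rfl]
  · simp
  · rw [← hPQ b, Finset.sum_filter]
  · beta_reduce
    split_ifs with hu
    · rw [← hsum]
      refine Finset.sum_le_sum fun X _ => ?_
      rw [Finset.sum_filter]
      calc _ ≤ ∑ Y, if φ X = Y then P X else 0 := by
              refine Finset.sum_le_sum fun Y _ => ?_
              split_ifs <;> simp [hP X]
        _ = P X := by simp
    · refine (Finset.sum_eq_zero fun X _ => Finset.sum_eq_zero fun Y hY => ?_).le
      rw [if_neg]
      rintro rfl
      exact (Finset.mem_filter.1 hY).2 (hφ X u hu).symm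

theorem refl (hP : ∀ σ, 0 ≤ P σ) : CoupledWithin P P fun _ => 0 := by
  refine ⟨fun X Y => if X = Y then P X else 0, ⟨fun a b => ?_, fun a => ?_, fun b => ?_⟩,
    fun u => ?_⟩
  · split_ifs
    exacts [hP a, le_rfl]
  · simp
  · simp
  · refine (Finset.sum_eq_zero fun X _ => Finset.sum_eq_zero fun Y hY => ?_).le
    rw [if_neg]
    rintro rfl
    exact (Finset.mem_filter.1 hY).2 rfl

/-- The gluing of two couplings. -/
theorem trans (h : CoupledWithin P Q f) (h' : CoupledWithin Q R g) :
    CoupledWithin P R fun u => f u + g u := by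
  obtain ⟨J, hJ, hf⟩ := h
  obtain ⟨K, hK, hg⟩ := h'
  have hQ : ∀ Y, 0 ≤ Q Y := fun Y => by
    rw [← hJ.right Y]
    exact Finset.sum_nonneg fun X _ => hJ.nonneg X Y
  have hL : ∀ X Y, ∑ Z, J X Y * K Y Z / Q Y = J X Y := fun X Y => by
    rw [← Finset.sum_div, ← Finset.mul_sum, hK.left]
    by_cases h0 : Q Y = 0
    · have : J X Y = 0 := (Finset.sum_eq_zero_iff_of_nonneg fun X _ => hJ.nonneg X Y).1
        ((hJ.right Y).trans h0) X (Finset.mem_univ _)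
      simp [this]
    · field_simp
  have hR : ∀ Y Z, ∑ X, J X Y * K Y Z / Q Y = K Y Z := fun Y Z => by
    rw [← Finset.sum_div, ← Finset.sum_mul, hJ.right]
    by_cases h0 : Q Y = 0
    · have : K Y Z = 0 := (Finset.sum_eq_zero_iff_of_nonneg fun Z _ => hK.nonneg Y Z).1
        ((hK.left Y).trans h0) Z (Finset.mem_univ _)
      simp [this]
    · field_simp
  have hpos : ∀ X Y Z, 0 ≤ J X Y * K Y Z / Q Y := fun X Y Z =>
    div_nonneg (mul_nonneg (hJ.nonneg X Y) (hK.nonneg Y Z)) (hQ Y)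
  refine ⟨fun X Z => ∑ Y, J X Y * K Y Z / Q Y,
    ⟨fun X Z => Finset.sum_nonneg fun Y _ => hpos X Y Z, fun X => ?_, fun Z => ?_⟩, fun u => ?_⟩
  · rw [Finset.sum_comm]
    simp only [hL, hJ.left]
  · rw [Finset.sum_comm]
    simp only [hR, hK.right]
  · calc ∑ X, ∑ Z with X u ≠ Z u, ∑ Y, J X Y * K Y Z / Q Y
        ≤ ∑ X, ∑ Z, ∑ Y, ((if X u ≠ Y u then J X Y * K Y Z / Q Y else 0)
            + if Y u ≠ Z u then J X Y * K Y Z / Q Y else 0) := by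
          refine Finset.sum_le_sum fun X _ => ?_
          rw [Finset.sum_filter]
          refine Finset.sum_le_sum fun Z _ => ?_
          split_ifs with hXZ
          · refine Finset.sum_le_sum fun Y _ => ?_
            by_cases hXY : X u = Y u
            · have : Y u ≠ Z u := hXY ▸ hXZ
              simp [hXY, this]
            · simp only [ne_eq, hXY, not_false_eq_true, if_true, le_add_iff_nonneg_right]
              split_ifs <;> first | exact le_rfl | exact hpos X Y Z
          · refine Finset.sum_nonneg fun Y _ => add_nonneg ?_ ?_ <;> split_ifs <;>
              first | exact hpos X Y Z | exact le_rfl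
      _ = (∑ X, ∑ Y, ∑ Z, if X u ≠ Y u then J X Y * K Y Z / Q Y else 0)
            + ∑ Y, ∑ Z, ∑ X, if Y u ≠ Z u then J X Y * K Y Z / Q Y else 0 := by
          simp only [Finset.sum_add_distrib]
          congr 1
          · exact Finset.sum_congr rfl fun X _ => Finset.sum_comm
          · rw [Finset.sum_comm' (t' := Finset.univ) (s' := fun _ => Finset.univ) (by simp)]
            rw [Finset.sum_comm]
            rw [Finset.sum_congr rfl fun Z _ => Finset.sum_comm]
            rw [Finset.sum_comm]
            refine Finset.sum_congr rfl fun Y _ => ?_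
            rw [Finset.sum_comm]
      _ = (∑ X, ∑ Y with X u ≠ Y u, J X Y) + ∑ Y, ∑ Z with Y u ≠ Z u, K Y Z := by
          congr 1
          · refine Finset.sum_congr rfl fun X _ => ?_
            rw [Finset.sum_filter]
            refine Finset.sum_congr rfl fun Y _ => ?_
            split_ifs
            exacts [hL X Y, by simp]
          · refine Finset.sum_congr rfl fun X _ => ?_
            rw [Finset.sum_filter]
            refine Finset.sum_congr rfl fun Y _ => ?_
            split_ifs
            exacts [hR X Y, by simp]
      _ ≤ f u + g u := add_le_add (hf u) (hg u)

/-- Two mixtures of the same two laws are coupled by coupling the choice of the law optimally. -/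
theorem mix (hP : ∀ σ, 0 ≤ P σ) (hQ : ∀ σ, 0 ≤ Q σ) (h : CoupledWithin P Q f) {p q : ℝ}
    (hp0 : 0 ≤ p) (hp1 : p ≤ 1) (hq0 : 0 ≤ q) (hq1 : q ≤ 1) :
    CoupledWithin (fun σ => p * Q σ + (1 - p) * P σ) (fun σ => q * Q σ + (1 - q) * P σ)
      fun u => |p - q| * f u := by
  wlog hpq : q ≤ p generalizing p q
  · rw [abs_sub_comm]
    exact (this hq0 hq1 hp0 hp1 (le_of_not_ge hpq)).symm
  have key := (((refl hQ).smul hq0).add (h.symm.smul (sub_nonneg.2 hpq))).add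
    ((refl hP).smul (sub_nonneg.2 hp1))
  convert key using 1
  · funext σ; ring
  · funext σ; ring
  · funext u; rw [abs_of_nonneg (sub_nonneg.2 hpq)]; ring

open Classical in
/-- A coupling of two laws induces one of their marginals. -/
theorem marginal (h : CoupledWithin P Q f) (S : Set V) :
    ∃ J : (S → Bool) → (S → Bool) → ℝ,
      IsCoupling (TwoSpin.marginal P S) (TwoSpin.marginal Q S) J ∧
      ∀ u : S, ∑ X : S → Bool, ∑ Y : S → Bool with X u ≠ Y u, J X Y ≤ f u := by
  obtain ⟨J, hJ, hf⟩ := h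
  have hr : ∀ (F : (S → Bool) → (V → Bool) → ℝ),
      ∑ ξ : S → Bool, ∑ σ : V → Bool with (∀ x : S, σ x = ξ x), F ξ σ
        = ∑ σ : V → Bool, F (fun x => σ x) σ := fun F => by
    simp only [Finset.sum_filter]
    rw [Finset.sum_comm]
    refine Finset.sum_congr rfl fun σ _ => ?_
    rw [Finset.sum_eq_single (fun x : S => σ x)]
    · simp
    · intro ξ _ hξ
      rw [if_neg]
      exact fun hc => hξ (funext fun x => (hc x).symm)
    · simp
  refine ⟨fun ξ η => ∑ σ : V → Bool with (∀ x : S, σ x = ξ x),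
      ∑ σ' : V → Bool with (∀ x : S, σ' x = η x), J σ σ',
    ⟨fun ξ η => Finset.sum_nonneg fun σ _ => Finset.sum_nonneg fun σ' _ => hJ.nonneg σ σ',
      fun ξ => ?_, fun η => ?_⟩, fun u => ?_⟩
  · rw [Finset.sum_comm]
    refine Finset.sum_congr rfl fun σ _ => ?_
    rw [hr fun _ σ' => J σ σ', hJ.left]
  · rw [hr fun _ σ => ∑ σ' : V → Bool with (∀ x : S, σ' x = η x), J σ σ', Finset.sum_comm]
    exact Finset.sum_congr rfl fun σ _ => hJ.right σ
  · refine le_trans (le_of_eq ?_) (hf u)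
    simp only [Finset.sum_filter (fun Y : S → Bool => _ ≠ Y u)]
    have : ∀ ξ : S → Bool, (∑ η : S → Bool, if ξ u ≠ η u then
        ∑ σ : V → Bool with (∀ x : S, σ x = ξ x),
          ∑ σ' : V → Bool with (∀ x : S, σ' x = η x), J σ σ' else 0)
        = ∑ σ : V → Bool with (∀ x : S, σ x = ξ x),
          ∑ σ' : V → Bool, if ξ u ≠ σ' u then J σ σ' else 0 := fun ξ => by
      calc _ = ∑ η : S → Bool, ∑ σ : V → Bool with (∀ x : S, σ x = ξ x),
          ∑ σ' : V → Bool with (∀ x : S, σ' x = η x), if ξ u ≠ η u then J σ σ' else 0 := by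
            refine Finset.sum_congr rfl fun η _ => ?_
            split_ifs <;> simp
        _ = _ := by
            rw [Finset.sum_comm]
            exact Finset.sum_congr rfl fun σ _ =>
              hr fun η σ' => if ξ u ≠ η u then J σ σ' else 0
    rw [Finset.sum_congr rfl fun ξ _ => this ξ,
      hr fun ξ σ => ∑ σ' : V → Bool, if ξ u ≠ σ' u then J σ σ' else 0]
    simp only [Finset.sum_filter]

end CoupledWithin

/-! ### Two-spin systems with arbitrary fields -/

section System

variable {V : Type*} [Fintype V] [DecidableEq V]

open Classical in
/-- The weight of `σ` in the system on `G` with a field `h x` at every vertex `x`. -/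
noncomputable def sysWeight (G : SimpleGraph V) (β γ : ℝ) (h : V → Bool → ℝ)
    (σ : V → Bool) : ℝ :=
  (∏ y, h y (σ y)) * ∏ e : Sym2 V with e ∈ G.edgeSet, edgeWeight β γ σ e

/-- The partition function of the system on `G` with fields `h`. -/
noncomputable def sysPartition (G : SimpleGraph V) (β γ : ℝ) (h : V → Bool → ℝ) : ℝ :=
  ∑ σ, sysWeight G β γ h σ

/-- The Gibbs distribution of the system on `G` with fields `h`. -/
noncomputable def sysLaw (G : SimpleGraph V) (β γ : ℝ) (h : V → Bool → ℝ) (σ : V → Bool) : ℝ :=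
  sysWeight G β γ h σ / sysPartition G β γ h

/-- The part of the partition function with spin `s` at `x`. -/
noncomputable def sysPartitionAt (G : SimpleGraph V) (β γ : ℝ) (h : V → Bool → ℝ) (x : V)
    (s : Bool) : ℝ :=
  ∑ σ with σ x = s, sysWeight G β γ h σ

/-- The graph without the edges at `x`. -/
def cut (G : SimpleGraph V) (x : V) : SimpleGraph V where
  Adj y z := G.Adj y z ∧ y ≠ x ∧ z ≠ x
  symm := ⟨fun _ _ h => ⟨h.1.symm, h.2.2, h.2.1⟩⟩
  loopless := ⟨fun _ h => h.1.ne rfl⟩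

open Classical in
/-- The fields after fixing `x` to `d` and multiplying the field of each neighbour `y` of `x` by
`F y`. -/
noncomputable def condFields (G : SimpleGraph V) (h : V → Bool → ℝ) (x : V) (d : Bool)
    (F : V → Bool → ℝ) : V → Bool → ℝ := fun y s =>
  if y = x then (if s = d then 1 else 0) else if G.Adj x y then h y s * F y s else h y s

/-- The fields with the field at `w` multiplied by `g`. -/
def mulField (h : V → Bool → ℝ) (w : V) (g : Bool → ℝ) : V → Bool → ℝ := fun y s =>
  if y = w then h y s * g s else h y s

/-- Fields for which the all-minus configuration (outside of the isolated vertices) is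
feasible. -/
structure FeasibleFields (G : SimpleGraph V) (h : V → Bool → ℝ) : Prop where
  nonneg : ∀ y s, 0 ≤ h y s
  pos : ∀ y z, G.Adj y z → 0 < h y false
  exists_pos : ∀ y, ∃ s, 0 < h y s

variable {G : SimpleGraph V} {β γ : ℝ} {h : V → Bool → ℝ}

theorem interaction_nonneg (hβ : 0 ≤ β) (hγ : 0 < γ) (a b : Bool) : 0 ≤ interaction β γ a b := by
  cases a <;> cases b <;> simp [interaction, hβ, hγ.le]

theorem interaction_false_pos (hγ : 0 < γ) (a : Bool) : 0 < interaction β γ a false := by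
  cases a <;> simp [interaction, hγ]

omit [Fintype V] [DecidableEq V] in
theorem edgeWeight_nonneg (hβ : 0 ≤ β) (hγ : 0 < γ) (σ : V → Bool) (e : Sym2 V) :
    0 ≤ edgeWeight β γ σ e := by
  induction e using Sym2.ind with
  | _ x y => exact interaction_nonneg hβ hγ _ _

omit [DecidableEq V] in
theorem FeasibleFields.sysWeight_nonneg (hβ : 0 ≤ β) (hγ : 0 < γ) (hh : FeasibleFields G h)
    (σ : V → Bool) : 0 ≤ sysWeight G β γ h σ :=
  mul_nonneg (Finset.prod_nonneg fun _ _ => hh.nonneg _ _)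
    (Finset.prod_nonneg fun _ _ => edgeWeight_nonneg hβ hγ _ _)

theorem FeasibleFields.sysPartition_pos (hβ : 0 ≤ β) (hγ : 0 < γ) (hh : FeasibleFields G h) :
    0 < sysPartition G β γ h := by
  classical
  refine Finset.sum_pos' (fun σ _ => hh.sysWeight_nonneg hβ hγ σ)
    ⟨fun y => decide (¬ 0 < h y false), Finset.mem_univ _, ?_⟩
  refine mul_pos (Finset.prod_pos fun y _ => ?_) (Finset.prod_pos fun e he => ?_)
  · by_cases hy : 0 < h y false
    · simp [hy]
    · obtain ⟨s, hs⟩ := hh.exists_pos y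
      cases s
      · exact absurd hs hy
      · simpa [hy] using hs
  · induction e using Sym2.ind with
    | _ y z =>
      have hyz : G.Adj y z := by simpa using he
      have hy : decide (¬ 0 < h y false) = false := by simpa using hh.pos y z hyz
      have hz : decide (¬ 0 < h z false) = false := by simpa using hh.pos z y hyz.symm
      simp only [edgeWeight, Sym2.lift_mk, hy, hz]
      exact hγ

theorem FeasibleFields.sysLaw_nonneg (hβ : 0 ≤ β) (hγ : 0 < γ) (hh : FeasibleFields G h)
    (σ : V → Bool) : 0 ≤ sysLaw G β γ h σ :=
  div_nonneg (hh.sysWeight_nonneg hβ hγ σ) (hh.sysPartition_pos hβ hγ).le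

theorem FeasibleFields.sum_sysLaw (hβ : 0 ≤ β) (hγ : 0 < γ) (hh : FeasibleFields G h) :
    ∑ σ, sysLaw G β γ h σ = 1 := by
  simp only [sysLaw]
  rw [← Finset.sum_div]
  exact div_self (hh.sysPartition_pos hβ hγ).ne'

omit [Fintype V] in
theorem FeasibleFields.condFields (hh : FeasibleFields G h) {F : V → Bool → ℝ} (x : V) (d : Bool)
    (hF : ∀ y s, 0 ≤ F y s) (hF' : ∀ y, 0 < F y false) :
    FeasibleFields (cut G x) (condFields G h x d F) where
  nonneg y s := by
    unfold TwoSpin.condFields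
    split_ifs
    exacts [zero_le_one, le_rfl, mul_nonneg (hh.nonneg _ _) (hF _ _), hh.nonneg _ _]
  pos y z hyz := by
    unfold TwoSpin.condFields
    rw [if_neg hyz.2.1]
    split_ifs
    exacts [mul_pos (hh.pos _ _ hyz.1) (hF' _), hh.pos _ _ hyz.1]
  exists_pos y := by
    unfold TwoSpin.condFields
    by_cases hy : y = x
    · exact ⟨d, by simp [hy]⟩
    · by_cases hxy : G.Adj x y
      · exact ⟨false, by simp [hy, hxy, hh.pos _ _ hxy.symm, hF']⟩
      · simpa [hy, hxy] using hh.exists_pos y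

omit [Fintype V] in
theorem FeasibleFields.mulField (hh : FeasibleFields G h) {g : Bool → ℝ} (w : V)
    (hg : ∀ s, 0 ≤ g s) (hg' : 0 < g false) (hw : 0 < h w false) :
    FeasibleFields G (mulField h w g) where
  nonneg y s := by
    unfold TwoSpin.mulField
    split_ifs
    exacts [mul_nonneg (hh.nonneg _ _) (hg _), hh.nonneg _ _]
  pos y z hyz := by
    unfold TwoSpin.mulField
    split_ifs
    exacts [mul_pos (hh.pos _ _ hyz) hg', hh.pos _ _ hyz]
  exists_pos y := by
    unfold TwoSpin.mulField
    by_cases hy : y = w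
    · subst hy
      exact ⟨false, by simpa using mul_pos hw hg'⟩
    · simpa [hy] using hh.exists_pos y

theorem sysWeight_mulField (w : V) (g : Bool → ℝ) (σ : V → Bool) :
    sysWeight G β γ (mulField h w g) σ = g (σ w) * sysWeight G β γ h σ := by
  unfold sysWeight
  rw [← mul_assoc]
  congr 1
  have : ∀ y, mulField h w g y (σ y) = (if y = w then g (σ y) else 1) * h y (σ y) := fun y => by
    unfold mulField
    split_ifs <;> ring
  rw [Finset.prod_congr rfl fun y _ => this y, Finset.prod_mul_distrib, Finset.prod_ite_eq']
  simp

open Classical in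
/-- The product over the edges, with the edges at `x` separated. -/
theorem prod_edges_eq_cut (G : SimpleGraph V) (β γ : ℝ) (x : V) (σ : V → Bool) :
    ∏ e : Sym2 V with e ∈ G.edgeSet, edgeWeight β γ σ e =
      (∏ y with G.Adj x y, interaction β γ (σ x) (σ y)) *
        ∏ e : Sym2 V with e ∈ (cut G x).edgeSet, edgeWeight β γ σ e := by
  rw [← Finset.prod_filter_mul_prod_filter_not _ (fun e : Sym2 V => x ∈ e)]
  congr 1
  · symm
    refine Finset.prod_bij (fun y _ => s(x, y)) ?_ ?_ ?_ ?_
    · intro y hy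
      simpa using hy
    · intro y _ z _ hyz
      exact Sym2.congr_right.1 hyz
    · intro e he
      simp only [Finset.mem_filter, Finset.mem_univ, true_and] at he
      obtain ⟨y, rfl⟩ := he.2
      exact ⟨y, by simpa using he.1, rfl⟩
    · intro y _
      rfl
  · refine Finset.prod_congr ?_ fun _ _ => rfl
    ext e
    induction e using Sym2.ind with
    | _ y z => simp [cut, eq_comm]

open Classical in
/-- The weight of the vertices other than `x`, where the neighbours of `x` have their fields
multiplied by `F`. -/
noncomputable def restWeight (G : SimpleGraph V) (β γ : ℝ) (h : V → Bool → ℝ) (x : V)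
    (F : V → Bool → ℝ) (σ : V → Bool) : ℝ :=
  (∏ y with y ≠ x, if G.Adj x y then h y (σ y) * F y (σ y) else h y (σ y)) *
    ∏ e : Sym2 V with e ∈ (cut G x).edgeSet, edgeWeight β γ σ e

theorem restWeight_update (x : V) (F : V → Bool → ℝ) (σ : V → Bool) (s : Bool) :
    restWeight G β γ h x F (Function.update σ x s) = restWeight G β γ h x F σ := by
  classical
  unfold restWeight
  congr 1
  · refine Finset.prod_congr rfl fun y hy => ?_
    rw [Function.update_of_ne (by simpa using hy)]
  · refine Finset.prod_congr rfl fun e he => ?_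
    induction e using Sym2.ind with
    | _ y z =>
      have he' : (cut G x).Adj y z := by simpa using he
      simp [edgeWeight, Function.update_of_ne he'.2.1, Function.update_of_ne he'.2.2]

theorem sysWeight_condFields (x : V) (d : Bool) (F : V → Bool → ℝ) (σ : V → Bool) :
    sysWeight (cut G x) β γ (condFields G h x d F) σ =
      if σ x = d then restWeight G β γ h x F σ else 0 := by
  classical
  unfold sysWeight restWeight
  rw [← Finset.mul_prod_erase Finset.univ _ (Finset.mem_univ x)]
  have h1 : condFields G h x d F x (σ x) = if σ x = d then 1 else 0 := by simp [condFields]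
  have h2 : ∏ y ∈ Finset.univ.erase x, condFields G h x d F y (σ y) =
      ∏ y with y ≠ x, if G.Adj x y then h y (σ y) * F y (σ y) else h y (σ y) := by
    refine Finset.prod_congr (by ext; simp) fun y hy => ?_
    rw [condFields, if_neg (by simpa using hy)]
  rw [h1, h2]
  split_ifs <;> simp

theorem sysWeight_eq_restWeight (x : V) (σ : V → Bool) :
    sysWeight G β γ h σ =
      h x (σ x) * restWeight G β γ h x (fun _ => interaction β γ (σ x)) σ := by
  classical
  unfold sysWeight restWeight
  rw [prod_edges_eq_cut G β γ x, ← Finset.mul_prod_erase Finset.univ _ (Finset.mem_univ x),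
    ← mul_assoc, mul_assoc (h x (σ x)), mul_assoc (h x (σ x))]
  congr 2
  have h3 : ∏ y with G.Adj x y, interaction β γ (σ x) (σ y) =
      ∏ y with y ≠ x, if G.Adj x y then interaction β γ (σ x) (σ y) else 1 := by
    rw [← Finset.prod_filter, Finset.filter_filter]
    refine Finset.prod_congr ?_ fun _ _ => rfl
    ext y
    simpa using fun hy : G.Adj x y => hy.ne'
  rw [h3, show Finset.univ.erase x = Finset.univ.filter (· ≠ x) by ext; simp,
    ← Finset.prod_mul_distrib]
  refine Finset.prod_congr rfl fun y _ => ?_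
  split_ifs <;> simp

/-- Fixing the spin at `x` gives the system on the rest with the fields of its neighbours
modified. -/
theorem sysPartitionAt_eq (x : V) (s : Bool) :
    sysPartitionAt G β γ h x s =
      h x s * sysPartition (cut G x) β γ (condFields G h x s fun _ => interaction β γ s) := by
  unfold sysPartitionAt sysPartition
  rw [Finset.mul_sum, Finset.sum_filter]
  refine Finset.sum_congr rfl fun σ _ => ?_
  rw [sysWeight_condFields]
  split_ifs with hs
  · rw [sysWeight_eq_restWeight x, hs]
  · simp

theorem sum_sysPartitionAt (x : V) :
    ∑ s, sysPartitionAt G β γ h x s = sysPartition G β γ h := by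
  unfold sysPartitionAt sysPartition
  exact Finset.sum_fiberwise _ _ _

theorem sysPartition_mulField (w : V) (g : Bool → ℝ) :
    sysPartition G β γ (mulField h w g) = ∑ s, g s * sysPartitionAt G β γ h w s := by
  rw [← sum_sysPartitionAt w]
  refine Finset.sum_congr rfl fun s _ => ?_
  unfold sysPartitionAt
  rw [Finset.mul_sum]
  refine Finset.sum_congr rfl fun σ hσ => ?_
  rw [sysWeight_mulField, (Finset.mem_filter.1 hσ).2]

/-- The Gibbs distribution is the mixture of the conditional distributions given the spin
at `w`. -/
theorem FeasibleFields.sysLaw_mulField (hβ : 0 ≤ β) (hγ : 0 < γ) (hh : FeasibleFields G h)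
    (w : V) (g : Bool → ℝ) (σ : V → Bool) :
    sysLaw G β γ (TwoSpin.mulField h w g) σ =
      ∑ s, g s * sysPartitionAt G β γ h w s / (∑ t, g t * sysPartitionAt G β γ h w t) *
        sysLaw (cut G w) β γ (TwoSpin.condFields G h w s fun _ => interaction β γ s) σ := by
  have hpos : ∀ s, sysPartition (cut G w) β γ
      (TwoSpin.condFields G h w s fun _ => interaction β γ s) ≠ 0 := fun s =>
    ((hh.condFields w s (fun _ => interaction_nonneg hβ hγ s)
      fun _ => interaction_false_pos hγ s).sysPartition_pos hβ hγ).ne'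
  have hterm : ∀ s, g s * sysPartitionAt G β γ h w s /
        (∑ t, g t * sysPartitionAt G β γ h w t) *
        sysLaw (cut G w) β γ (TwoSpin.condFields G h w s fun _ => interaction β γ s) σ =
      (if σ w = s then g (σ w) * sysWeight G β γ h σ else 0) /
        ∑ t, g t * sysPartitionAt G β γ h w t := fun s => by
    have hp := hpos s
    rw [sysPartitionAt_eq w s]
    unfold sysLaw
    rw [sysWeight_condFields]
    split_ifs with hs
    · rw [sysWeight_eq_restWeight w, hs, div_mul_div_comm]
      rw [show g s * (h w s * sysPartition (cut G w) β γ
          (TwoSpin.condFields G h w s fun _ => interaction β γ s)) *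
          restWeight G β γ h w (fun _ => interaction β γ s) σ =
        (g s * (h w s * restWeight G β γ h w (fun _ => interaction β γ s) σ)) *
          sysPartition (cut G w) β γ
          (TwoSpin.condFields G h w s fun _ => interaction β γ s) by ring]
      exact mul_div_mul_right _ _ hp
    · simp
  rw [Finset.sum_congr rfl fun s _ => hterm s, ← Finset.sum_div, Finset.sum_ite_eq]
  simp [sysLaw, sysPartition_mulField, sysWeight_mulField]

theorem sysPartition_condFields_spin (x : V) (d d' : Bool) (F : V → Bool → ℝ) :
    sysPartition (cut G x) β γ (condFields G h x d F) =
      sysPartition (cut G x) β γ (condFields G h x d' F) := by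
  unfold sysPartition
  simp only [sysWeight_condFields, ← Finset.sum_filter]
  refine Finset.sum_bij' (fun σ _ => Function.update σ x d') (fun σ _ => Function.update σ x d)
    ?_ ?_ ?_ ?_ ?_
  · simp
  · simp
  · intro σ hσ
    have : σ x = d := by simpa using hσ
    simp [← this]
  · intro σ hσ
    have : σ x = d' := by simpa using hσ
    simp [← this]
  · intro σ _
    rw [restWeight_update]

/-- Changing the spin of the isolated vertex `x` is a coupling that disagrees at `x` only. -/
theorem FeasibleFields.coupledWithin_condFields_spin (hβ : 0 ≤ β) (hγ : 0 < γ) {x : V}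
    {F : V → Bool → ℝ} (d d' : Bool)
    (hh : FeasibleFields (cut G x) (TwoSpin.condFields G h x d F)) :
    CoupledWithin (sysLaw (cut G x) β γ (TwoSpin.condFields G h x d F))
      (sysLaw (cut G x) β γ (TwoSpin.condFields G h x d' F)) fun u => if u = x then 1 else 0 := by
  refine CoupledWithin.of_map (hh.sysLaw_nonneg hβ hγ) (fun σ => Function.update σ x d') x
    (fun σ u hu => Function.update_of_ne hu _ _) (fun ξ => ?_) (hh.sum_sysLaw hβ hγ)
  unfold sysLaw
  rw [← Finset.sum_div, sysPartition_condFields_spin x d d']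
  congr 1
  simp only [sysWeight_condFields]
  rw [← Finset.sum_filter, Finset.filter_filter]
  split_ifs with hξ
  · rw [Finset.sum_eq_single (Function.update ξ x d)]
    · exact restWeight_update _ _ _ _
    · intro σ hσ hne
      simp only [Finset.mem_filter, Finset.mem_univ, true_and] at hσ
      refine absurd ?_ hne
      rw [← hσ.1, Function.update_idem, ← hσ.2, Function.update_eq_self]
    · intro hn
      simp [← hξ] at hn
  · refine Finset.sum_eq_zero fun σ hσ => absurd ?_ hξ
    simp only [Finset.mem_filter, Finset.mem_univ, true_and] at hσ
    rw [← hσ.1, Function.update_self]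

end System

/-! ### Averages over configurations -/

section Average

variable {ι : Type*} [Fintype ι] [DecidableEq ι]

/-- The average of `f` over all configurations. -/
noncomputable def avg (f : (ι → Bool) → ℝ) : ℝ := (∑ σ, f σ) / Fintype.card (ι → Bool)

theorem avg_mul {f g : (ι → Bool) → ℝ} {B : Set ι} (hf : DependsOn f B) (hg : DependsOn g Bᶜ) :
    avg (fun σ => f σ * g σ) = avg f * avg g := by
  classical
  have key : (∑ σ, f σ) * ∑ σ, g σ = Fintype.card (ι → Bool) * ∑ σ, f σ * g σ := by
    let m : (ι → Bool) × (ι → Bool) → (ι → Bool) × (ι → Bool) :=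
      fun q => (B.piecewise q.1 q.2, B.piecewise q.2 q.1)
    have hm : Function.Involutive m := by
      rintro ⟨σ, σ'⟩
      ext i <;> by_cases hi : i ∈ B <;> simp [m, hi]
    calc (∑ σ, f σ) * ∑ σ, g σ = ∑ q : (ι → Bool) × (ι → Bool), f q.1 * g q.2 := by
          rw [Finset.sum_mul_sum, Fintype.sum_prod_type]
      _ = ∑ q : (ι → Bool) × (ι → Bool), f (m q).1 * g (m q).1 := by
          refine Finset.sum_congr rfl fun q _ => ?_
          congr 1
          · exact hf fun i hi => by simp [m, hi]
          · exact hg fun i hi => by simp [m, show i ∉ B from hi]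
      _ = ∑ q : (ι → Bool) × (ι → Bool), f q.1 * g q.1 :=
          Equiv.sum_comp hm.toPerm fun q : (ι → Bool) × (ι → Bool) => f q.1 * g q.1
      _ = _ := by
          rw [Fintype.sum_prod_type]
          simp [Finset.mul_sum]
  have hc : (Fintype.card (ι → Bool) : ℝ) ≠ 0 := by exact_mod_cast Fintype.card_ne_zero
  unfold avg
  rw [div_mul_div_comm, key, mul_div_mul_left _ _ hc]

theorem avg_one : avg (fun _ : ι → Bool => 1) = 1 := by
  have hc : (Fintype.card (ι → Bool) : ℝ) ≠ 0 := by exact_mod_cast Fintype.card_ne_zero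
  unfold avg
  rw [Finset.sum_const, Finset.card_univ, nsmul_one, div_self hc]

theorem avg_prod {κ : Type*} (s : Finset κ) (f : κ → (ι → Bool) → ℝ) (B : κ → Set ι)
    (hf : ∀ i ∈ s, DependsOn (f i) (B i)) (hB : (s : Set κ).PairwiseDisjoint B) :
    avg (fun σ => ∏ i ∈ s, f i σ) = ∏ i ∈ s, avg (f i) := by
  classical
  induction s using Finset.induction_on with
  | empty => simp [avg_one]
  | insert a s ha ih =>
    simp only [Finset.prod_insert ha]
    rw [avg_mul (hf a (Finset.mem_insert_self a s)), ih]
    · exact fun i hi => hf i (Finset.mem_insert_of_mem hi)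
    · exact hB.subset (by simp)
    · intro σ σ' h
      refine Finset.prod_congr rfl fun i hi => hf i (Finset.mem_insert_of_mem hi) fun j hj => ?_
      refine h j fun hja => ?_
      have hne : i ≠ a := fun h' => ha (h' ▸ hi)
      exact Set.disjoint_left.1 (hB (by simp [hi]) (by simp) hne) hj hja

theorem avg_const_mul (c : ℝ) (f : (ι → Bool) → ℝ) : avg (fun σ => c * f σ) = c * avg f := by
  unfold avg
  rw [← Finset.mul_sum, mul_div_assoc]

theorem avg_eq_update (a : ι) (f : (ι → Bool) → ℝ) :
    avg f = (∑ t, avg fun σ => f (Function.update σ a t)) / 2 := by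
  have key : 2 * ∑ σ, f σ = ∑ t : Bool, ∑ σ, f (Function.update σ a t) := by
    rw [Finset.sum_comm]
    have h1 : ∀ σ : ι → Bool, ∑ t : Bool, f (Function.update σ a t) =
        f σ + f (Function.update σ a (!σ a)) := fun σ => by
      cases h : σ a
      · have := Function.update_eq_self a σ
        rw [h] at this
        simp [this, add_comm]
      · have := Function.update_eq_self a σ
        rw [h] at this
        simp [this]
    have hinv : Function.Involutive fun σ : ι → Bool => Function.update σ a (!σ a) := by
      intro σ
      simp
    rw [Finset.sum_congr rfl fun σ _ => h1 σ, Finset.sum_add_distrib,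
      show ∑ σ, f (Function.update σ a (!σ a)) = ∑ σ, f σ from Equiv.sum_comp hinv.toPerm f,
      two_mul]
  unfold avg
  rw [← Finset.sum_div, ← key]
  ring

end Average

/-! ### Spin systems on rooted trees -/

/-- A rooted tree, given by the parent map. -/
structure RootedTree (N : Type*) where
  par : N → N
  root : N
  depth : N → ℕ
  par_root : par root = root
  depth_par : ∀ a, a ≠ root → depth (par a) < depth a

namespace RootedTree

variable {N : Type*} (T : RootedTree N)

/-- The set of the nodes of the subtree at `a`. -/
def desc (a : N) : Set N := {d | ∃ n, T.par^[n] d = a}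

/-- The set of the nodes strictly below `a`. -/
def below (a : N) : Set N := {d | d ≠ a ∧ d ∈ T.desc a}

/-- The set of the children of `a`. -/
def children (a : N) : Set N := {b | b ≠ T.root ∧ T.par b = a}

variable {T} {a b d : N}

theorem mem_below : d ∈ T.below a ↔ d ≠ a ∧ d ∈ T.desc a := Iff.rfl

theorem self_mem_desc (a : N) : a ∈ T.desc a := ⟨0, rfl⟩

theorem desc_of_par (h : T.par d ∈ T.desc a) : d ∈ T.desc a := by
  obtain ⟨n, hn⟩ := h
  exact ⟨n + 1, hn⟩

theorem par_mem_desc (h : d ∈ T.below a) : T.par d ∈ T.desc a := by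
  obtain ⟨hne, n, hn⟩ := h
  cases n with
  | zero => exact absurd hn hne
  | succ n => exact ⟨n, hn⟩

theorem ne_root_of_mem_below (h : d ∈ T.below a) : d ≠ T.root := by
  rintro rfl
  obtain ⟨hne, n, hn⟩ := h
  rw [Function.iterate_fixed T.par_root] at hn
  exact hne hn

theorem depth_iterate_le (n : ℕ) (d : N) : T.depth (T.par^[n] d) ≤ T.depth d := by
  induction n generalizing d with
  | zero => exact le_rfl
  | succ n ih =>
    refine (ih (T.par d)).trans ?_
    by_cases hd : d = T.root
    · rw [hd, T.par_root]
    · exact (T.depth_par d hd).le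

theorem depth_le (h : d ∈ T.desc a) : T.depth a ≤ T.depth d := by
  obtain ⟨n, rfl⟩ := h
  exact depth_iterate_le n d

theorem par_notMem_desc (ha : a ≠ T.root) : T.par a ∉ T.desc a := fun h =>
  (T.depth_par a ha).not_ge (depth_le h)

theorem desc_trans_par (h : d ∈ T.desc b) : d ∈ T.desc (T.par b) := by
  obtain ⟨n, rfl⟩ := h
  exact ⟨n + 1, Function.iterate_succ_apply' _ _ _⟩

theorem mem_below_of_child (hb : b ∈ T.children a) (hd : d ∈ T.desc b) : d ∈ T.below a := by
  obtain ⟨hb, rfl⟩ := hb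
  refine ⟨?_, desc_trans_par hd⟩
  rintro rfl
  exact par_notMem_desc hb hd

theorem exists_child (h : d ∈ T.below a) : ∃ b ∈ T.children a, d ∈ T.desc b := by
  obtain ⟨hne, n, hn⟩ := h
  induction n generalizing d with
  | zero => exact absurd hn hne
  | succ n ih =>
    by_cases hp : T.par d = a
    · refine ⟨d, ⟨?_, hp⟩, self_mem_desc d⟩
      rintro rfl
      exact hne (T.par_root ▸ hp)
    · obtain ⟨b, hb, hdb⟩ := ih hp hn
      exact ⟨b, hb, desc_of_par hdb⟩

theorem disjoint_desc {b' : N} (hb : b ∈ T.children a) (hb' : b' ∈ T.children a) (hne : b ≠ b') :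
    Disjoint (T.desc b) (T.desc b') := by
  rw [Set.disjoint_left]
  have aux : ∀ {b b' : N}, b ∈ T.children a → b' ∈ T.children a → b ≠ b' → ∀ (d : N) (n m : ℕ),
      n ≤ m → T.par^[n] d = b → T.par^[m] d = b' → False := by
    intro b b' hb hb' hne d n m hnm hn hm
    obtain ⟨j, rfl⟩ := Nat.exists_eq_add_of_le' hnm
    rw [Function.iterate_add_apply, hn] at hm
    cases j with
    | zero => exact hne hm
    | succ j =>
      rw [Function.iterate_succ_apply, hb.2] at hm
      have h1 := depth_iterate_le (T := T) j a
      rw [hm] at h1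
      have h2 := T.depth_par b' hb'.1
      rw [hb'.2] at h2
      omega
  rintro d ⟨n, hn⟩ ⟨m, hm⟩
  rcases le_total n m with h | h
  · exact aux hb hb' hne d n m h hn hm
  · exact aux hb' hb hne.symm d m n h hm hn

variable [Fintype N] [DecidableEq N] (T) (k : N → Bool → Bool → ℝ)

open Classical in
/-- The weight of the subtree at `a` given the spin of `a`; the factor `2` compensates for the
normalization of `avg`. -/
noncomputable def subWeight (a : N) (σ : N → Bool) : ℝ :=
  ∏ d with d ∈ T.below a, 2 * k d (σ (T.par d)) (σ d)

/-- The partition function of the subtree at `a` with spin `t` at `a`. -/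
noncomputable def subPartition (a : N) (t : Bool) : ℝ :=
  avg fun σ => T.subWeight k a (Function.update σ a t)

/-- The message from `a` to its parent. -/
noncomputable def message (a : N) (s : Bool) : ℝ := ∑ t, k a s t * T.subPartition k a t

/-- The difference of the two conditional probabilities of `+` at `a`, given the spin of the
parent of `a`. -/
noncomputable def edgeInfluence (a : N) : ℝ :=
  k a true true * T.subPartition k a true / T.message k a true -
    k a false true * T.subPartition k a true / T.message k a false

/-- The weight of `σ` in the system on the whole tree, with root fixed to `c`. -/
noncomputable def rootedWeight (c : Bool) (σ : N → Bool) : ℝ :=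
  (if σ T.root = c then 1 else 0) * ∏ d with d ≠ T.root, k d (σ (T.par d)) (σ d)

variable {T k}

omit [DecidableEq N] in
theorem dependsOn_subWeight (a : N) : DependsOn (T.subWeight k a) (T.desc a) := by
  classical
  intro σ σ' h
  refine Finset.prod_congr rfl fun d hd => ?_
  have hd' : d ∈ T.below a := by simpa using hd
  rw [h _ (par_mem_desc hd'), h _ hd'.2]

/-- The recursion for the partition functions of the subtrees. -/
theorem subPartition_eq_prod (a : N) (t : Bool) [DecidablePred (· ∈ T.children a)] :
    T.subPartition k a t = ∏ b with b ∈ T.children a, T.message k b t := by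
  classical
  have h1 : ∀ σ : N → Bool, T.subWeight k a (Function.update σ a t) =
      ∏ b with b ∈ T.children a, 2 * k b t (σ b) * T.subWeight k b σ := fun σ => by
    have hU : Finset.univ.filter (· ∈ T.below a) =
        (Finset.univ.filter (· ∈ T.children a)).biUnion
          fun b => Finset.univ.filter (· ∈ T.desc b) := by
      ext d
      simp only [Finset.mem_filter, Finset.mem_univ, true_and, Finset.mem_biUnion]
      exact ⟨exists_child, fun ⟨b, hb, hd⟩ => mem_below_of_child hb hd⟩
    unfold subWeight
    rw [hU, Finset.prod_biUnion]
    · refine Finset.prod_congr rfl fun b hb => ?_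
      have hb' : b ∈ T.children a := by simpa using hb
      have hI : Finset.univ.filter (· ∈ T.desc b) =
          insert b (Finset.univ.filter (· ∈ T.below b)) := by
        ext d
        by_cases hd : d = b
        · simp [hd, self_mem_desc]
        · simp [hd, mem_below]
      rw [hI, Finset.prod_insert (by simp [mem_below])]
      congr 1
      · rw [hb'.2, Function.update_self,
          Function.update_of_ne (mem_below_of_child hb' (self_mem_desc b)).1]
      · refine Finset.prod_congr rfl fun d hd => ?_
        have hd' : d ∈ T.below b := by simpa using hd
        rw [Function.update_of_ne (mem_below_of_child hb' hd'.2).1,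
          Function.update_of_ne (mem_below_of_child hb' (par_mem_desc hd')).1]
    · intro b hb b' hb' hne
      simp only [Finset.coe_filter, Finset.mem_univ, true_and, Set.mem_ofPred_eq] at hb hb'
      rw [Function.onFun, Finset.disjoint_left]
      intro d hd hd'
      simp only [Finset.mem_filter, Finset.mem_univ, true_and] at hd hd'
      exact Set.disjoint_left.1 (disjoint_desc hb hb' hne) hd hd'
  unfold subPartition
  rw [funext h1, avg_prod _ _ T.desc]
  · refine Finset.prod_congr rfl fun b _ => ?_
    rw [avg_eq_update b]
    unfold message subPartition
    rw [Finset.sum_div]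
    refine Finset.sum_congr rfl fun t' _ => ?_
    simp only [Function.update_self]
    rw [avg_const_mul]
    ring
  · intro b _ σ σ' h
    dsimp only
    rw [h b (self_mem_desc b), dependsOn_subWeight b h]
  · intro b hb b' hb' hne
    simp only [Finset.coe_filter, Finset.mem_univ, true_and, Set.mem_ofPred_eq] at hb hb'
    exact disjoint_desc hb hb' hne

/-- The joint law of the spins of `a` and of its parent. -/
theorem exists_sum_rootedWeight_eq {a : N} (ha : a ≠ T.root) (c s : Bool) :
    ∃ M : ℝ, ∀ t, ∑ σ : N → Bool, (if σ (T.par a) = s ∧ σ a = t then T.rootedWeight k c σ else 0)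
      = M * (k a s t * T.subPartition k a t) := by
  classical
  set m := (Finset.univ.filter (· ∈ T.below a)).card with hm
  let out : (N → Bool) → ℝ := fun σ => (if σ (T.par a) = s then 1 else 0) *
    ((if σ T.root = c then 1 else 0) *
      ∏ d with d ≠ T.root ∧ d ∉ T.desc a, k d (σ (T.par d)) (σ d))
  have hcard : (Fintype.card (N → Bool) : ℝ) ≠ 0 := by exact_mod_cast Fintype.card_ne_zero
  have hroot : T.root ∉ T.desc a := fun h => by
    obtain ⟨n, hn⟩ := h
    rw [Function.iterate_fixed T.par_root] at hn
    exact ha hn.symm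
  have hout : DependsOn out (T.desc a)ᶜ := by
    intro σ σ' h
    simp only [out]
    rw [h _ (par_notMem_desc ha), h _ hroot]
    congr 2
    refine Finset.prod_congr rfl fun d hd => ?_
    simp only [Finset.mem_filter, Finset.mem_univ, true_and] at hd
    rw [h d hd.2, h (T.par d) fun hp => hd.2 (desc_of_par hp)]
  refine ⟨Fintype.card (N → Bool) * avg out / 2 ^ m / 2, fun t => ?_⟩
  let ins : (N → Bool) → ℝ := fun σ => (if σ a = t then 1 else 0) * T.subWeight k a σ
  have hins : DependsOn ins (T.desc a) := by
    intro σ σ' h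
    simp only [ins]
    rw [h a (self_mem_desc a), dependsOn_subWeight a h]
  have havg : avg ins = T.subPartition k a t / 2 := by
    rw [avg_eq_update a]
    congr 1
    rw [Fintype.sum_eq_single t]
    · simp [ins, subPartition]
    · intro t' ht'
      simp [ins, ht', avg]
  have hfac : ∀ σ : N → Bool,
      (if σ (T.par a) = s ∧ σ a = t then T.rootedWeight k c σ else 0) =
        k a s t / 2 ^ m * (out σ * ins σ) := fun σ => by
    have hU : Finset.univ.filter (· ≠ T.root) = insert a
        ((Finset.univ.filter fun d => d ≠ T.root ∧ d ∉ T.desc a) ∪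
          Finset.univ.filter (· ∈ T.below a)) := by
      ext d
      simp only [Finset.mem_filter, Finset.mem_univ, true_and, Finset.mem_insert,
        Finset.mem_union]
      constructor
      · intro hd
        by_cases hda : d = a
        · exact Or.inl hda
        · by_cases hdd : d ∈ T.desc a
          · exact Or.inr (Or.inr ⟨hda, hdd⟩)
          · exact Or.inr (Or.inl ⟨hd, hdd⟩)
      · rintro (rfl | h | h)
        exacts [ha, h.1, ne_root_of_mem_below h]
    have hsub : T.subWeight k a σ =
        2 ^ m * ∏ d with d ∈ T.below a, k d (σ (T.par d)) (σ d) := by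
      unfold subWeight
      rw [Finset.prod_mul_distrib, Finset.prod_const]
    simp only [out, ins, rootedWeight]
    rw [hU, Finset.prod_insert, Finset.prod_union, hsub]
    · by_cases h1 : σ (T.par a) = s <;> by_cases h2 : σ a = t
      · rw [if_pos ⟨h1, h2⟩, if_pos h1, if_pos h2, h1, h2]
        have : (2 : ℝ) ^ m ≠ 0 := by positivity
        field_simp
      · simp [h2]
      · simp [h1]
      · simp [h1]
    · rw [Finset.disjoint_left]
      intro d hd hd'
      simp only [Finset.mem_filter, Finset.mem_univ, true_and] at hd hd'
      exact hd.2 hd'.2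
    · simp [mem_below, self_mem_desc]
  rw [Finset.sum_congr rfl fun σ _ => hfac σ, ← Finset.mul_sum]
  have hmul : avg (fun σ => out σ * ins σ) = avg out * avg ins := by
    have := avg_mul hins hout
    rw [mul_comm (avg out), ← this]
    simp only [mul_comm]
  rw [havg] at hmul
  have hsum : ∑ σ, out σ * ins σ =
      Fintype.card (N → Bool) * avg fun σ => out σ * ins σ := by
    unfold avg
    field_simp
  rw [hsum, hmul]
  ring

/-- The influence of the root is multiplied by the edge influence along every edge. -/
theorem plusProb_sub_plusProb {a : N} (ha : a ≠ T.root)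
    (hZ : ∀ c, ∑ σ, T.rootedWeight k c σ ≠ 0) (hmsg : ∀ s, T.message k a s ≠ 0) :
    plusProb (fun σ => T.rootedWeight k true σ / ∑ σ', T.rootedWeight k true σ') a -
        plusProb (fun σ => T.rootedWeight k false σ / ∑ σ', T.rootedWeight k false σ') a =
      (plusProb (fun σ => T.rootedWeight k true σ / ∑ σ', T.rootedWeight k true σ') (T.par a) -
        plusProb (fun σ => T.rootedWeight k false σ / ∑ σ', T.rootedWeight k false σ')
          (T.par a)) * T.edgeInfluence k a := by
  have key : ∀ c, plusProb (fun σ => T.rootedWeight k c σ / ∑ σ', T.rootedWeight k c σ') a =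
      plusProb (fun σ => T.rootedWeight k c σ / ∑ σ', T.rootedWeight k c σ') (T.par a) *
        T.edgeInfluence k a +
      k a false true * T.subPartition k a true / T.message k a false := fun c => by
    choose M hM using exists_sum_rootedWeight_eq (T := T) (k := k) ha c
    have hZc := hZ c
    set Z := ∑ σ', T.rootedWeight k c σ' with hZdef
    have hpair : ∀ s, ∑ σ : N → Bool, (if σ (T.par a) = s then T.rootedWeight k c σ else 0)
        = M s * T.message k a s := fun s => by
      unfold message
      rw [Finset.mul_sum, ← Finset.sum_congr rfl fun t _ => hM s t, Finset.sum_comm]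
      refine Finset.sum_congr rfl fun σ _ => ?_
      by_cases h : σ (T.par a) = s <;> simp [h]
    have hZ' : Z = M true * T.message k a true + M false * T.message k a false := by
      rw [← hpair, ← hpair, hZdef, ← Finset.sum_add_distrib]
      refine Finset.sum_congr rfl fun σ _ => ?_
      cases σ (T.par a) <;> simp
    have hpa : plusProb (fun σ => T.rootedWeight k c σ / Z) a =
        (M true * (k a true true * T.subPartition k a true) +
          M false * (k a false true * T.subPartition k a true)) / Z := by
      rw [← hM, ← hM, ← Finset.sum_add_distrib]
      unfold plusProb
      rw [← Finset.sum_div, Finset.sum_filter]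
      congr 1
      refine Finset.sum_congr rfl fun σ _ => ?_
      cases σ (T.par a) <;> cases σ a <;> simp
    have hpb : plusProb (fun σ => T.rootedWeight k c σ / Z) (T.par a) =
        M true * T.message k a true / Z := by
      rw [← hpair]
      unfold plusProb
      rw [← Finset.sum_div, Finset.sum_filter]
    rw [hpa, hpb]
    unfold edgeInfluence
    have h1 := hmsg true
    have h2 := hmsg false
    field_simp
    rw [hZ']
    ring
  rw [key true, key false]
  ring

end RootedTree

/-! ### The self-avoiding-walk tree as a rooted tree -/

theorem RootedTree.leaf_induction {N : Type*} [Finite N] (T : RootedTree N) {P : N → Prop}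
    (h : ∀ a, (∀ b ∈ T.children a, P b) → P a) (a : N) : P a := by
  obtain ⟨M, hM⟩ := (Set.finite_range T.depth).bddAbove
  have hM' : ∀ a, T.depth a ≤ M := fun a => hM ⟨a, rfl⟩
  induction hn : M - T.depth a using Nat.strong_induction_on generalizing a with
  | _ n ih =>
    refine h a fun b hb => ih (M - T.depth b) ?_ b rfl
    have h1 := T.depth_par b hb.1
    rw [hb.2] at h1
    have h2 := hM' b
    omega

section Nodes

variable {V : Type*} {G : SimpleGraph V} {τ : Pinning V} {r : V}

theorem isSAWNode_cons_cons {x y : V} {p : List V} :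
    IsSAWNode G τ r (y :: x :: p) ↔
      IsSAWNode G τ r (x :: p) ∧ x ∉ p ∧ τ x = none ∧ G.Adj x y ∧ p.head? ≠ some y := by
  constructor
  · intro h
    cases h with
    | step hp hx hτ hxy hback => exact ⟨hp, hx, hτ, hxy, hback⟩
  · rintro ⟨hp, hx, hτ, hxy, hback⟩
    exact .step hp hx hτ hxy hback

theorem IsSAWNode.ne_nil {l : List V} (h : IsSAWNode G τ r l) : l ≠ [] := by
  cases h <;> simp

theorem isSAWNode_singleton {x : V} : IsSAWNode G τ r [x] ↔ x = r := by
  constructor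
  · intro h
    cases h
    rfl
  · rintro rfl
    exact .root

theorem IsSAWNode.tail {l : List V} (h : IsSAWNode G τ r l) (hl : l.tail ≠ []) :
    IsSAWNode G τ r l.tail := by
  cases h with
  | root => exact absurd rfl hl
  | step hp => exact hp

theorem IsSAWNode.free_of_mem_tail {l : List V} (h : IsSAWNode G τ r l) :
    ∀ z ∈ l.tail, τ z = none := by
  induction h with
  | root => simp
  | step hp hx hτ hxy hback ih =>
    intro z hz
    rcases List.mem_cons.1 hz with rfl | hz
    exacts [hτ, ih z hz]

open Classical in
/-- The self-avoiding-walk tree as a rooted tree. -/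
noncomputable def sawRooted (G : SimpleGraph V) (τ : Pinning V) (r : V) :
    RootedTree (SAWNode G τ r) where
  par a := if h : a.1.tail ≠ [] then ⟨a.1.tail, a.2.tail h⟩ else sawRoot G τ r
  root := sawRoot G τ r
  depth a := a.1.length
  par_root := by simp [sawRoot]
  depth_par := by
    rintro ⟨l, hl⟩ ha
    match l, hl with
    | [], hl => exact absurd rfl hl.ne_nil
    | [x], hl =>
      obtain rfl := isSAWNode_singleton.1 hl
      exact absurd rfl ha
    | y :: x :: p, hl => simp

theorem sawRooted_par_cons {y x : V} {p : List V} (h : IsSAWNode G τ r (y :: x :: p)) :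
    (sawRooted G τ r).par ⟨y :: x :: p, h⟩ = ⟨x :: p, (isSAWNode_cons_cons.1 h).1⟩ := by
  simp [sawRooted]

theorem eq_cons_par {a : SAWNode G τ r} (ha : a ≠ sawRoot G τ r) :
    ∃ y, a.1 = y :: ((sawRooted G τ r).par a).1 := by
  obtain ⟨l, hl⟩ := a
  match l, hl with
  | [], hl => exact absurd rfl hl.ne_nil
  | [x], hl =>
    obtain rfl := isSAWNode_singleton.1 hl
    exact absurd rfl ha
  | y :: x :: p, hl => exact ⟨y, by rw [sawRooted_par_cons]⟩

theorem mem_children_iff {a b : SAWNode G τ r} :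
    b ∈ (sawRooted G τ r).children a ↔ ∃ y, b.1 = y :: a.1 := by
  constructor
  · rintro ⟨hb, rfl⟩
    exact eq_cons_par hb
  · rintro ⟨y, hy⟩
    obtain ⟨l, hl⟩ := b
    obtain ⟨l', hl'⟩ := a
    subst hy
    match l', hl' with
    | [], hl' => exact absurd rfl hl'.ne_nil
    | x :: p, hl' =>
      refine ⟨fun h => ?_, ?_⟩
      · have := congrArg (fun c : SAWNode G τ r => c.1.length) h
        simp [sawRooted, sawRoot] at this
      · exact sawRooted_par_cons hl

open Classical in
/-- A product over the children of a node as a product over vertices. -/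
@[to_additive /-- A sum over the children of a node as a sum over vertices. -/]
theorem prod_children [Fintype V] {M : Type*} [CommMonoid M] (a : SAWNode G τ r)
    (f : SAWNode G τ r → M) :
    ∏ b with b ∈ (sawRooted G τ r).children a, f b =
      ∏ y, if h : IsSAWNode G τ r (y :: a.1) then f ⟨y :: a.1, h⟩ else 1 := by
  have hhead : ∀ b : SAWNode G τ r, b.1 ≠ [] := fun b => b.2.ne_nil
  have h1 : ∏ y, (if h : IsSAWNode G τ r (y :: a.1) then f ⟨y :: a.1, h⟩ else 1) =
      ∏ y with IsSAWNode G τ r (y :: a.1),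
        if h : IsSAWNode G τ r (y :: a.1) then f ⟨y :: a.1, h⟩ else 1 := by
    rw [Finset.prod_filter]
    refine Finset.prod_congr rfl fun y _ => ?_
    split_ifs <;> rfl
  rw [h1]
  refine Finset.prod_bij (fun b _ => b.1.head (hhead b)) ?_ ?_ ?_ ?_
  · intro b hb
    obtain ⟨y, hy⟩ := mem_children_iff.1 (Finset.mem_filter.1 hb).2
    have := b.2
    rw [hy] at this
    simpa [hy] using this
  · intro b hb b' hb' heq
    obtain ⟨y, hy⟩ := mem_children_iff.1 (Finset.mem_filter.1 hb).2
    obtain ⟨y', hy'⟩ := mem_children_iff.1 (Finset.mem_filter.1 hb').2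
    simp only [hy, hy', List.head_cons] at heq
    exact Subtype.ext (by rw [hy, hy', heq])
  · intro y hy
    have hy' : IsSAWNode G τ r (y :: a.1) := (Finset.mem_filter.1 hy).2
    exact ⟨⟨y :: a.1, hy'⟩, by simpa using mem_children_iff.2 ⟨y, rfl⟩, rfl⟩
  · intro b hb
    obtain ⟨y, hy⟩ := mem_children_iff.1 (Finset.mem_filter.1 hb).2
    have hb2 := b.2
    rw [hy] at hb2
    have hbe : b = ⟨y :: a.1, hb2⟩ := Subtype.ext hy
    subst hbe
    simp [hb2]

end Nodes

section Weights

variable {V : Type*} [LinearOrder V] {G : SimpleGraph V} {τ : Pinning V} {r : V}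

theorem sawPinning_root (hr : τ r = none) : sawPinning G τ r (sawRoot G τ r) = none := by
  simp [sawPinning, sawRoot, hr]

theorem sawPinning_cons {x : V} {p : List V} (h : IsSAWNode G τ r (x :: p)) :
    sawPinning G τ r ⟨x :: p, h⟩ = if x ∈ p then some (cycleSpin x p) else τ x := rfl

theorem sawPinning_par (hr : τ r = none) (a : SAWNode G τ r) :
    sawPinning G τ r ((sawRooted G τ r).par a) = none := by
  obtain ⟨l, hl⟩ := a
  match l, hl with
  | [], hl => exact absurd rfl hl.ne_nil
  | [x], hl =>
    obtain rfl := isSAWNode_singleton.1 hl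
    rw [show (sawRooted G τ x).par ⟨[x], hl⟩ = sawRoot G τ x by simp [sawRooted]]
    exact sawPinning_root hr
  | y :: x :: p, hl =>
    rw [sawRooted_par_cons, sawPinning_cons]
    obtain ⟨-, hx, hτ, -⟩ := isSAWNode_cons_cons.1 hl
    rw [if_neg hx, hτ]

/-- The contribution of a node with spin `s`, and of the edge to its parent with spin `s'`, to
the weight on the self-avoiding-walk tree with pinned root. -/
noncomputable def sawKernel (G : SimpleGraph V) (β γ lam : ℝ) (τ : Pinning V) (r : V)
    (a : SAWNode G τ r) (s' s : Bool) : ℝ :=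
  match sawPinning G τ r a with
  | none => field lam s * interaction β γ s' s
  | some c => if s = c then
      (if (sawRooted G τ r).par a = sawRoot G τ r then 1 else interaction β γ s' s) else 0

theorem sawKernel_of_none {β γ lam : ℝ} {a : SAWNode G τ r} (h : sawPinning G τ r a = none)
    (s' s : Bool) : sawKernel G β γ lam τ r a s' s = field lam s * interaction β γ s' s := by
  simp [sawKernel, h]

theorem sawKernel_of_some {β γ lam : ℝ} {a : SAWNode G τ r} {c : Bool}
    (h : sawPinning G τ r a = some c) (s' s : Bool) :
    sawKernel G β γ lam τ r a s' s = if s = c then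
      (if (sawRooted G τ r).par a = sawRoot G τ r then 1 else interaction β γ s' s) else 0 := by
  simp [sawKernel, h]

variable [Fintype V]

open Classical in
theorem prod_sawTree_edges (hr : τ r = none) (β γ : ℝ) (c : Bool) (σ : SAWNode G τ r → Bool) :
    ∏ e : Sym2 (SAWNode G τ r) with (e ∈ (sawTree G τ r).edgeSet ∧
        ∃ x ∈ e, (sawPinning G τ r).and (sawRoot G τ r) c x = none), edgeWeight β γ σ e =
      ∏ a with a ≠ sawRoot G τ r ∧ (sawPinning G τ r a = none ∨
          (sawRooted G τ r).par a ≠ sawRoot G τ r),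
        interaction β γ (σ ((sawRooted G τ r).par a)) (σ a) := by
  have hfree : ∀ x, (sawPinning G τ r).and (sawRoot G τ r) c x = none ↔
      x ≠ sawRoot G τ r ∧ sawPinning G τ r x = none := fun x => by
    by_cases hx : x = sawRoot G τ r
    · simp [Pinning.and, hx]
    · simp [Pinning.and, hx]
  symm
  refine Finset.prod_bij (fun a _ => s((sawRooted G τ r).par a, a)) ?_ ?_ ?_ ?_
  · intro a ha
    simp only [Finset.mem_filter, Finset.mem_univ, true_and] at ha ⊢
    obtain ⟨y, hy⟩ := eq_cons_par ha.1
    refine ⟨?_, ?_⟩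
    · rw [SimpleGraph.mem_edgeSet, sawTree, SimpleGraph.fromRel_adj]
      refine ⟨fun h => ?_, Or.inl ⟨y, hy⟩⟩
      have := congrArg (fun d : SAWNode G τ r => d.1.length) h
      simp [hy] at this
    · rcases ha.2 with h | h
      · exact ⟨a, by simp, (hfree a).2 ⟨ha.1, h⟩⟩
      · exact ⟨_, by simp, (hfree _).2 ⟨h, sawPinning_par hr a⟩⟩
  · intro a ha b hb hab
    simp only [Finset.mem_filter, Finset.mem_univ, true_and] at ha hb
    rcases Sym2.eq_iff.1 hab with h | ⟨h1, h2⟩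
    · exact h.2
    · obtain ⟨y, hy⟩ := eq_cons_par ha.1
      obtain ⟨z, hz⟩ := eq_cons_par hb.1
      have e1 := congrArg List.length hy
      have e2 := congrArg List.length hz
      rw [h1] at e1
      rw [← h2] at e2
      simp only [List.length_cons] at e1 e2
      omega
  · intro e he
    simp only [Finset.mem_filter, Finset.mem_univ, true_and] at he
    obtain ⟨he, x, hx, hxf⟩ := he
    rw [hfree] at hxf
    have key : ∀ a b : SAWNode G τ r, (∃ y, b.1 = y :: a.1) → x ∈ s(a, b) →
        ∃ d, ∃ _ : d ∈ Finset.univ.filter fun a : SAWNode G τ r => a ≠ sawRoot G τ r ∧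
          (sawPinning G τ r a = none ∨ (sawRooted G τ r).par a ≠ sawRoot G τ r),
          s((sawRooted G τ r).par d, d) = s(a, b) := by
      intro a b hab hx
      obtain ⟨hb, hpar⟩ := mem_children_iff.2 hab
      refine ⟨b, ?_, by rw [hpar]⟩
      simp only [Finset.mem_filter, Finset.mem_univ, true_and]
      refine ⟨hb, ?_⟩
      rcases Sym2.mem_iff.1 hx with rfl | rfl
      · exact Or.inr (hpar ▸ hxf.1)
      · exact Or.inl hxf.2
    induction e using Sym2.ind with
    | _ a b =>
      rw [SimpleGraph.mem_edgeSet, sawTree, SimpleGraph.fromRel_adj] at he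
      rcases he.2 with h | h
      · exact key a b h hx
      · rw [Sym2.eq_swap] at hx ⊢
        exact key b a h hx
  · intro a _
    rfl

/-- The weight on the self-avoiding-walk tree with root fixed to `c`. -/
theorem weight_sawTree (hr : τ r = none) (β γ lam : ℝ) (c : Bool) (σ : SAWNode G τ r → Bool) :
    weight (sawTree G τ r) β γ lam ((sawPinning G τ r).and (sawRoot G τ r) c) σ =
      (sawRooted G τ r).rootedWeight (sawKernel G β γ lam τ r) c σ := by
  classical
  have hroot : (sawRooted G τ r).root = sawRoot G τ r := rfl
  unfold weight RootedTree.rootedWeight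
  rw [hroot]
  split_ifs with hag hc hc
  · rw [prod_sawTree_edges hr, one_mul]
    have h1 : ∏ x with (sawPinning G τ r).and (sawRoot G τ r) c x = none, field lam (σ x) =
        ∏ x with x ≠ sawRoot G τ r,
          if sawPinning G τ r x = none then field lam (σ x) else 1 := by
      rw [← Finset.prod_filter, Finset.filter_filter]
      refine Finset.prod_congr ?_ fun _ _ => rfl
      ext x
      simp only [Finset.mem_filter, Finset.mem_univ, true_and]
      by_cases hx : x = sawRoot G τ r <;> simp [Pinning.and, hx]
    rw [h1, ← Finset.filter_filter,
      Finset.prod_filter (s := Finset.univ.filter fun a => a ≠ sawRoot G τ r),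
      ← Finset.prod_mul_distrib]
    refine Finset.prod_congr rfl fun a ha => ?_
    have ha' : a ≠ sawRoot G τ r := (Finset.mem_filter.1 ha).2
    cases hp : sawPinning G τ r a with
    | none => simp [sawKernel_of_none hp]
    | some s =>
      have hs : σ a = s := hag a s (by rw [Pinning.and, Function.update_of_ne ha', hp])
      rw [sawKernel_of_some hp, if_pos hs]
      by_cases h : (sawRooted G τ r).par a = sawRoot G τ r <;> simp [h]
  · exact absurd (hag (sawRoot G τ r) c (by simp [Pinning.and])) hc
  · symm
    rw [one_mul]
    unfold Pinning.Agrees at hag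
    push Not at hag
    obtain ⟨a, s, has, hne⟩ := hag
    by_cases ha : a = sawRoot G τ r
    · subst ha
      simp only [Pinning.and, Function.update_self, Option.some.injEq] at has
      exact absurd (hc.trans has) hne
    · rw [Pinning.and, Function.update_of_ne ha] at has
      refine Finset.prod_eq_zero (i := a) (by simpa using ha) ?_
      rw [sawKernel_of_some has, if_neg hne]
  · rw [zero_mul]

variable {β γ lam : ℝ}

omit [Fintype V] in
theorem sawKernel_nonneg (hβ : 0 ≤ β) (hγ : 0 < γ) (hlam : 0 < lam) (a : SAWNode G τ r)
    (s' s : Bool) : 0 ≤ sawKernel G β γ lam τ r a s' s := by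
  unfold sawKernel
  have := interaction_nonneg hβ hγ s' s
  split
  · exact mul_nonneg (by cases s <;> simp [field, hlam.le]) this
  · split_ifs
    exacts [zero_le_one, this, le_rfl]

theorem subPartition_nonneg (hβ : 0 ≤ β) (hγ : 0 < γ) (hlam : 0 < lam) (a : SAWNode G τ r)
    (t : Bool) : 0 ≤ (sawRooted G τ r).subPartition (sawKernel G β γ lam τ r) a t :=
  div_nonneg (Finset.sum_nonneg fun _ _ => Finset.prod_nonneg fun _ _ =>
    mul_nonneg zero_le_two (sawKernel_nonneg hβ hγ hlam _ _ _)) (Nat.cast_nonneg _)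

omit [Fintype V] in
/-- A pinned node is a leaf. -/
theorem not_isSAWNode_cons_of_pinned {a : SAWNode G τ r} {c : Bool}
    (h : sawPinning G τ r a = some c) (y : V) : ¬ IsSAWNode G τ r (y :: a.1) := by
  obtain ⟨l, hl⟩ := a
  match l, hl with
  | [], hl => exact absurd rfl hl.ne_nil
  | x :: p, hl =>
    intro hy
    obtain ⟨-, hx, hτ, -⟩ := isSAWNode_cons_cons.1 hy
    rw [sawPinning_cons, if_neg hx, hτ] at h
    exact absurd h (by simp)

theorem subPartition_of_pinned {a : SAWNode G τ r} {c : Bool}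
    (h : sawPinning G τ r a = some c) (t : Bool) :
    (sawRooted G τ r).subPartition (sawKernel G β γ lam τ r) a t = 1 := by
  classical
  rw [RootedTree.subPartition_eq_prod, prod_children]
  exact Finset.prod_eq_one fun y _ => dif_neg (not_isSAWNode_cons_of_pinned h y)

theorem message_of_pinned {a : SAWNode G τ r} {c : Bool} (h : sawPinning G τ r a = some c)
    (s : Bool) : (sawRooted G τ r).message (sawKernel G β γ lam τ r) a s =
      if (sawRooted G τ r).par a = sawRoot G τ r then 1 else interaction β γ s c := by
  unfold RootedTree.message
  simp only [sawKernel_of_some h, subPartition_of_pinned h, mul_one]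
  simp

theorem message_of_free {a : SAWNode G τ r} (h : sawPinning G τ r a = none)
    (s : Bool) : (sawRooted G τ r).message (sawKernel G β γ lam τ r) a s =
      ∑ t, interaction β γ s t *
        (field lam t * (sawRooted G τ r).subPartition (sawKernel G β γ lam τ r) a t) := by
  unfold RootedTree.message
  refine Finset.sum_congr rfl fun t _ => ?_
  rw [sawKernel_of_none h]
  ring

theorem message_pos_of_free (hβ : 0 ≤ β) (hγ : 0 < γ) (hlam : 0 < lam) {a : SAWNode G τ r}
    (h : sawPinning G τ r a = none)
    (hW : 0 < (sawRooted G τ r).subPartition (sawKernel G β γ lam τ r) a false) (s : Bool) :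
    0 < (sawRooted G τ r).message (sawKernel G β γ lam τ r) a s := by
  rw [message_of_free h]
  refine Finset.sum_pos' (fun t _ => ?_) ⟨false, Finset.mem_univ _, ?_⟩
  · refine mul_nonneg (interaction_nonneg hβ hγ s t)
      (mul_nonneg ?_ (subPartition_nonneg hβ hγ hlam a t))
    cases t <;> simp [field, hlam.le]
  · exact mul_pos (interaction_false_pos hγ s) (mul_pos (by simp [field]) hW)

theorem subPartition_false_pos (hβ : 0 ≤ β) (hγ : 0 < γ) (hlam : 0 < lam) (a : SAWNode G τ r) :
    0 < (sawRooted G τ r).subPartition (sawKernel G β γ lam τ r) a false := by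
  classical
  induction a using (sawRooted G τ r).leaf_induction with
  | h a ih =>
    rw [RootedTree.subPartition_eq_prod]
    refine Finset.prod_pos fun b hb => ?_
    have hb' := (Finset.mem_filter.1 hb).2
    cases hp : sawPinning G τ r b with
    | none => exact message_pos_of_free hβ hγ hlam hp (ih b hb') false
    | some c =>
      rw [message_of_pinned hp]
      split_ifs
      · exact zero_lt_one
      · rw [interaction_comm]
        exact interaction_false_pos hγ c

theorem message_pos (hβ : 0 ≤ β) (hγ : 0 < γ) (hlam : 0 < lam) {a : SAWNode G τ r}
    (h : sawPinning G τ r a = none) (s : Bool) :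
    0 < (sawRooted G τ r).message (sawKernel G β γ lam τ r) a s :=
  message_pos_of_free hβ hγ hlam h (subPartition_false_pos hβ hγ hlam a) s

theorem gibbs_sawTree (hr : τ r = none) (c : Bool) :
    gibbs (sawTree G τ r) β γ lam ((sawPinning G τ r).and (sawRoot G τ r) c) = fun σ =>
      (sawRooted G τ r).rootedWeight (sawKernel G β γ lam τ r) c σ /
        ∑ σ', (sawRooted G τ r).rootedWeight (sawKernel G β γ lam τ r) c σ' := by
  funext σ
  unfold gibbs partition
  simp only [weight_sawTree hr]

/-- The influence of the root on a free node is its influence on the parent times the influence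
along the edge. -/
theorem influence_sawTree (hβ : 0 ≤ β) (hγ : 0 < γ) (hlam : 0 < lam) (hr : τ r = none)
    {a : SAWNode G τ r} (ha : a ≠ sawRoot G τ r) (h : sawPinning G τ r a = none) :
    influence (sawTree G τ r) β γ lam (sawPinning G τ r) (sawRoot G τ r) a =
      influence (sawTree G τ r) β γ lam (sawPinning G τ r) (sawRoot G τ r)
          ((sawRooted G τ r).par a) *
        (sawRooted G τ r).edgeInfluence (sawKernel G β γ lam τ r) a := by
  unfold influence
  rw [gibbs_sawTree hr, gibbs_sawTree hr]
  refine RootedTree.plusProb_sub_plusProb ha (fun c => ?_)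
    fun s => (message_pos hβ hγ hlam h s).ne'
  have := partition_pos (sawTree G τ r) hβ hγ hlam ((sawPinning G τ r).and (sawRoot G τ r) c)
  unfold partition at this
  simp only [weight_sawTree hr] at this
  exact this.ne'

end Weights

/-- The influence of a vertex on itself. -/
theorem influence_self {V : Type*} [Fintype V] [DecidableEq V] (G : SimpleGraph V)
    {β γ lam : ℝ} (hβ : 0 ≤ β) (hγ : 0 < γ) (hlam : 0 < lam) (τ : Pinning V) (v : V) :
    influence G β γ lam τ v v = 1 := by
  have hw : ∀ c σ, σ v ≠ c → gibbs G β γ lam (τ.and v c) σ = 0 := fun c σ hσ => by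
    unfold gibbs weight
    rw [if_neg fun h => hσ (h v c (by simp [Pinning.and])), zero_div]
  have h1 : plusProb (gibbs G β γ lam (τ.and v true)) v = 1 := by
    unfold plusProb
    rw [Finset.sum_filter_of_ne fun σ _ h => not_not.1 (mt (hw true σ) h)]
    unfold gibbs
    rw [← Finset.sum_div]
    exact div_self (partition_pos G hβ hγ hlam (τ.and v true)).ne'
  have h2 : plusProb (gibbs G β γ lam (τ.and v false)) v = 0 := by
    unfold plusProb
    refine Finset.sum_eq_zero fun σ hσ => hw false σ ?_
    simp [(Finset.mem_filter.1 hσ).2]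
  rw [influence, h1, h2, sub_zero]

/-! ### The systems on the graph that correspond to the nodes of the tree -/

section NodeSystems

variable {V : Type*}

/-- The edges between free vertices that are not on the walk `l`. -/
def activeGraph (G : SimpleGraph V) (τ : Pinning V) (l : List V) : SimpleGraph V where
  Adj y z := G.Adj y z ∧ (y ∉ l ∧ τ y = none) ∧ z ∉ l ∧ τ z = none
  symm := ⟨fun _ _ h => ⟨h.1.symm, h.2.2, h.2.1⟩⟩
  loopless := ⟨fun _ h => h.1.ne rfl⟩

theorem cut_activeGraph (G : SimpleGraph V) (τ : Pinning V) (l : List V) (x : V) :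
    cut (activeGraph G τ l) x = activeGraph G τ (x :: l) := by
  ext y z
  simp only [cut, activeGraph, List.mem_cons]
  tauto

/-- The factor that a neighbour with pinning `o` contributes to the field. -/
def pinFactor (β γ : ℝ) (o : Option Bool) (s : Bool) : ℝ :=
  match o with
  | none => 1
  | some c => interaction β γ c s

open Classical in
/-- The fields of the pinned system, where the pinned vertices are absorbed in the fields of their
neighbours. -/
noncomputable def pinnedFields [Fintype V] (G : SimpleGraph V) (β γ lam : ℝ) (τ : Pinning V) :
    V → Bool → ℝ := fun y s =>
  match τ y with
  | none => field lam s * ∏ z, if G.Adj y z then pinFactor β γ (τ z) s else 1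
  | some c => if s = c then 1 else 0

variable [LinearOrder V]

/-- The factor for the neighbour `y` of a removed vertex, after the step of the walk from that
vertex to `w`. -/
noncomputable def stepFactor (β γ : ℝ) (w : V) : V → Bool → ℝ := fun y s =>
  if y = w then 1 else interaction β γ (decide (w < y)) s

/-- The fields of the system for the walk `l` (written as a reversed list). -/
noncomputable def nodeFields [Fintype V] (G : SimpleGraph V) (β γ lam : ℝ) (τ : Pinning V) :
    List V → V → Bool → ℝ
  | [] => pinnedFields G β γ lam τ
  | [_] => pinnedFields G β γ lam τ
  | w :: x :: p => condFields (activeGraph G τ p) (nodeFields G β γ lam τ (x :: p)) x true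
      (stepFactor β γ w)

/-- The vertex that follows `z` on the walk `l` (written as a reversed list). -/
def nextVertex (z : V) : List V → V
  | [] => z
  | [_] => z
  | w :: x :: p => if x = z then w else nextVertex z (x :: p)

theorem nextVertex_cons {z : V} (x : V) {p : List V} (hz : z ∈ p) :
    nextVertex z (x :: p) = (p.takeWhile fun y => decide (y ≠ z)).getLastD x := by
  induction p generalizing x with
  | nil => simp at hz
  | cons y p ih =>
    by_cases hy : y = z
    · simp [nextVertex, hy]
    · have hz' : z ∈ p := (List.mem_cons.1 hz).resolve_left (Ne.symm hy)
      have htw : (y :: p).takeWhile (fun y => decide (y ≠ z)) =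
          y :: p.takeWhile fun y => decide (y ≠ z) := by simp [hy]
      rw [htw, List.getLastD_cons, ← ih y hz']
      simp [nextVertex, hy]

theorem cycleSpin_eq {x z : V} {p : List V} (hz : z ∈ p) (hxz : x ≠ z) :
    cycleSpin z (x :: p) = decide (nextVertex z (x :: p) < x) := by
  rw [nextVertex_cons x hz]
  unfold cycleSpin
  simp [hxz]

theorem nextVertex_mem {z x : V} {p : List V} (hz : z ∈ p) : nextVertex z (x :: p) ∈ x :: p := by
  induction p generalizing x with
  | nil => simp at hz
  | cons y p ih =>
    by_cases hy : y = z
    · simp [nextVertex, hy]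
    · have hz' : z ∈ p := (List.mem_cons.1 hz).resolve_left (Ne.symm hy)
      simp only [nextVertex, if_neg hy]
      exact List.mem_cons_of_mem _ (ih hz')

theorem nextVertex_eq_iff {x z : V} {p : List V} (hz : z ∈ p) (hx : x ∉ p) :
    nextVertex z (x :: p) = x ↔ p.head? = some z := by
  cases p with
  | nil => simp at hz
  | cons y p =>
    by_cases hy : y = z
    · simp [nextVertex, hy]
    · have hz' : z ∈ p := (List.mem_cons.1 hz).resolve_left (Ne.symm hy)
      simp only [nextVertex, List.head?_cons, Option.some.injEq, hy, iff_false, if_false]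
      exact fun h => hx (h ▸ nextVertex_mem hz')

theorem stepFactor_nonneg {β γ : ℝ} (hβ : 0 ≤ β) (hγ : 0 < γ) (w y : V) (s : Bool) :
    0 ≤ stepFactor β γ w y s := by
  unfold stepFactor
  split_ifs
  exacts [zero_le_one, interaction_nonneg hβ hγ _ _]

theorem stepFactor_false_pos {β γ : ℝ} (hγ : 0 < γ) (w y : V) :
    0 < stepFactor β γ w y false := by
  unfold stepFactor
  split_ifs
  exacts [zero_lt_one, interaction_false_pos hγ _]

variable [Fintype V] {G : SimpleGraph V} {β γ lam : ℝ} {τ : Pinning V} {r : V}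

omit [LinearOrder V] in
theorem feasibleFields_pinnedFields (hβ : 0 ≤ β) (hγ : 0 < γ) (hlam : 0 < lam) :
    FeasibleFields (activeGraph G τ []) (pinnedFields G β γ lam τ) := by
  have hpin : ∀ o s, 0 ≤ pinFactor β γ o s := fun o s => by
    cases o
    exacts [zero_le_one, interaction_nonneg hβ hγ _ _]
  have hpin' : ∀ o, 0 < pinFactor β γ o false := fun o => by
    cases o
    exacts [zero_lt_one, interaction_false_pos hγ _]
  have hpos : ∀ y, τ y = none → 0 < pinnedFields G β γ lam τ y false := fun y hy => by
    simp only [pinnedFields, hy]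
    refine mul_pos (by simp [field]) (Finset.prod_pos fun z _ => ?_)
    split_ifs
    exacts [hpin' _, zero_lt_one]
  refine ⟨fun y s => ?_, fun y z hyz => hpos y hyz.2.1.2, fun y => ?_⟩
  · unfold pinnedFields
    split
    · refine mul_nonneg (by cases s <;> simp [field, hlam.le]) (Finset.prod_nonneg fun z _ => ?_)
      split_ifs
      exacts [hpin _ _, zero_le_one]
    · split_ifs
      exacts [zero_le_one, le_rfl]
  · cases hy : τ y with
    | none => exact ⟨false, hpos y hy⟩
    | some c => exact ⟨c, by simp [pinnedFields, hy]⟩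

theorem feasibleFields_nodeFields (hβ : 0 ≤ β) (hγ : 0 < γ) (hlam : 0 < lam) (x : V)
    (p : List V) :
    FeasibleFields (activeGraph G τ p) (nodeFields G β γ lam τ (x :: p)) := by
  induction p generalizing x with
  | nil => exact feasibleFields_pinnedFields hβ hγ hlam
  | cons y p ih =>
    rw [← cut_activeGraph]
    exact (ih y).condFields y true (fun _ _ => stepFactor_nonneg hβ hγ _ _ _)
      fun _ => stepFactor_false_pos hγ _ _

open Classical in
/-- The fields of the system for a walk, with the contributions of the vertices on the walk. -/
theorem nodeFields_apply {w : V} {q : List V} (h : IsSAWNode G τ r (w :: q)) {y : V}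
    (hy : y ∉ q) (hτ : τ y = none) (s : Bool) :
    nodeFields G β γ lam τ (w :: q) y s = pinnedFields G β γ lam τ y s *
      ∏ z, if z ∈ q ∧ G.Adj z y ∧ nextVertex z (w :: q) ≠ y then
        interaction β γ (decide (nextVertex z (w :: q) < y)) s else 1 := by
  induction q generalizing w with
  | nil => simp [nodeFields]
  | cons x p ih =>
    obtain ⟨hp, hx, hτx, -⟩ := isSAWNode_cons_cons.1 h
    simp only [List.mem_cons, not_or] at hy
    have hadj : (activeGraph G τ p).Adj x y ↔ G.Adj x y := by simp [activeGraph, *]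
    have hterm : ∀ z, (if z ∈ x :: p ∧ G.Adj z y ∧ nextVertex z (w :: x :: p) ≠ y then
          interaction β γ (decide (nextVertex z (w :: x :: p) < y)) s else 1) =
        (if z ∈ p ∧ G.Adj z y ∧ nextVertex z (x :: p) ≠ y then
          interaction β γ (decide (nextVertex z (x :: p) < y)) s else 1) *
        if z = x then (if G.Adj x y then stepFactor β γ w y s else 1) else 1 := fun z => by
      by_cases hz : z = x
      · subst hz
        simp only [List.mem_cons, true_or, true_and, nextVertex, if_true, hx, false_and, if_false,
          one_mul, stepFactor]
        by_cases ha : G.Adj z y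
        · by_cases hwy : w = y
          · simp [hwy]
          · simp [ha, hwy, Ne.symm hwy]
        · simp [ha]
      · simp [nextVertex, hz, Ne.symm hz]
    rw [Finset.prod_congr rfl fun z _ => hterm z, Finset.prod_mul_distrib, Finset.prod_ite_eq',
      ← mul_assoc, ← ih hp hy.2, if_pos (Finset.mem_univ _)]
    simp only [nodeFields, condFields, if_neg hy.1, hadj]
    split_ifs <;> simp

end NodeSystems

/-! ### Comparison of the marginals on the graph and on the tree -/

section Weitz

variable {V : Type*} [Fintype V] [LinearOrder V] {G : SimpleGraph V} {β γ lam : ℝ}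
  {τ : Pinning V} {r : V}

omit [Fintype V] in
/-- The neighbours of a free node in the graph of active vertices are its free children. -/
theorem activeGraph_adj_iff {x : V} {p : List V} (h : IsSAWNode G τ r (x :: p)) (hx : x ∉ p)
    (hτ : τ x = none) (w : V) :
    (activeGraph G τ p).Adj x w ↔
      ∃ h' : IsSAWNode G τ r (w :: x :: p), sawPinning G τ r ⟨w :: x :: p, h'⟩ = none := by
  constructor
  · rintro ⟨hxw, -, hw, hτw⟩
    refine ⟨.step h hx hτ hxw fun hh => hw (List.mem_of_mem_head? hh), ?_⟩
    rw [sawPinning_cons, if_neg, hτw]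
    rw [List.mem_cons, not_or]
    exact ⟨hxw.ne', hw⟩
  · rintro ⟨h', hp⟩
    rw [sawPinning_cons] at hp
    split_ifs at hp with hw
    rw [List.mem_cons, not_or] at hw
    exact ⟨(isSAWNode_cons_cons.1 h').2.2.2.1, ⟨hx, hτ⟩, hw.2, hp⟩

/-- The fields of the system without `x`, where the neighbours of `x` in `S` see the spin `-` at
`x` and the others see the spin `+`. -/
noncomputable def hybridFields (G : SimpleGraph V) (β γ lam : ℝ) (τ : Pinning V) (x : V)
    (p : List V) (S : Finset V) : V → Bool → ℝ :=
  condFields (activeGraph G τ p) (nodeFields G β γ lam τ (x :: p)) x true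
    fun y => interaction β γ (decide (y ∉ S))

theorem feasibleFields_hybridFields (hβ : 0 ≤ β) (hγ : 0 < γ) (hlam : 0 < lam) (x : V)
    (p : List V) (S : Finset V) :
    FeasibleFields (cut (activeGraph G τ p) x) (hybridFields G β γ lam τ x p S) :=
  (feasibleFields_nodeFields hβ hγ hlam x p).condFields x true
    (fun _ _ => interaction_nonneg hβ hγ _ _) fun _ => interaction_false_pos hγ _

theorem hybridFields_of_adj {x w : V} {p : List V} (hw : (activeGraph G τ p).Adj x w)
    {S : Finset V} (hS : ∀ y, y ≠ w → (y ∈ S ↔ y < w)) :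
    hybridFields G β γ lam τ x p S = mulField (nodeFields G β γ lam τ (w :: x :: p)) w
      (interaction β γ (decide (w ∉ S))) := by
  funext y s
  have hwx : w ≠ x := hw.ne'
  unfold hybridFields mulField
  simp only [nodeFields, condFields]
  by_cases hyw : y = w
  · subst hyw
    simp [hwx, hw, stepFactor]
  · have hlt : y ∉ S ↔ w < y := by
      rw [hS y hyw, not_lt]
      exact ⟨fun h => lt_of_le_of_ne h (Ne.symm hyw), le_of_lt⟩
    simp only [if_neg hyw, stepFactor, hlt]

theorem hybridFields_insert_of_not_adj {x w : V} {p : List V}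
    (hw : ¬ (activeGraph G τ p).Adj x w) (S : Finset V) :
    hybridFields G β γ lam τ x p (insert w S) = hybridFields G β γ lam τ x p S := by
  funext y s
  simp only [hybridFields, condFields]
  by_cases hyw : y = w
  · subst hyw
    simp [hw]
  · simp [hyw]

/-- The marginals of the system for the node at the node agree, up to normalization, with those
of the subtree. -/
def MarginalsAgree (G : SimpleGraph V) (β γ lam : ℝ) (τ : Pinning V) (r : V) (x : V) (p : List V)
    (h : IsSAWNode G τ r (x :: p)) : Prop :=
  ∃ ρ : ℝ, 0 < ρ ∧ ∀ t, sysPartitionAt (activeGraph G τ p) β γ (nodeFields G β γ lam τ (x :: p))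
    x t = ρ * (field lam t *
      (sawRooted G τ r).subPartition (sawKernel G β γ lam τ r) ⟨x :: p, h⟩ t)

open Classical in
/-- The message from the child `w` of the node `x :: p` if that child exists and is free, and `1`
otherwise. -/
noncomputable def freeMessage (G : SimpleGraph V) (β γ lam : ℝ) (τ : Pinning V) (r : V) (x : V)
    (p : List V) (w : V) (s : Bool) : ℝ :=
  if h : ∃ h' : IsSAWNode G τ r (w :: x :: p), sawPinning G τ r ⟨w :: x :: p, h'⟩ = none then
    (sawRooted G τ r).message (sawKernel G β γ lam τ r) ⟨w :: x :: p, h.choose⟩ s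
  else 1

theorem freeMessage_pos (hβ : 0 ≤ β) (hγ : 0 < γ) (hlam : 0 < lam) (x : V) (p : List V) (w : V)
    (s : Bool) : 0 < freeMessage G β γ lam τ r x p w s := by
  unfold freeMessage
  split_ifs with h
  exacts [message_pos hβ hγ hlam h.choose_spec s, zero_lt_one]

theorem sysPartition_mulField_of_marginalsAgree {x w : V} {p : List V}
    {h : IsSAWNode G τ r (w :: x :: p)} (hp : sawPinning G τ r ⟨w :: x :: p, h⟩ = none) {ρ : ℝ}
    (hρ : ∀ t, sysPartitionAt (activeGraph G τ (x :: p)) β γ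
      (nodeFields G β γ lam τ (w :: x :: p)) w t = ρ * (field lam t *
        (sawRooted G τ r).subPartition (sawKernel G β γ lam τ r) ⟨w :: x :: p, h⟩ t)) (s : Bool) :
    sysPartition (activeGraph G τ (x :: p)) β γ
        (mulField (nodeFields G β γ lam τ (w :: x :: p)) w (interaction β γ s)) =
      ρ * (sawRooted G τ r).message (sawKernel G β γ lam τ r) ⟨w :: x :: p, h⟩ s := by
  rw [sysPartition_mulField, message_of_free hp, Finset.mul_sum]
  refine Finset.sum_congr rfl fun t _ => ?_
  rw [hρ]
  ring

/-- Telescoping over the neighbours of `x`. -/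
theorem sysPartition_hybridFields {x : V} {p : List V} (h : IsSAWNode G τ r (x :: p))
    (hx : x ∉ p) (hτ : τ x = none)
    (hch : ∀ w (h' : IsSAWNode G τ r (w :: x :: p)),
      sawPinning G τ r ⟨w :: x :: p, h'⟩ = none →
        MarginalsAgree G β γ lam τ r w (x :: p) h')
    (S : Finset V) (hS : ∀ y ∈ S, ∀ z, z < y → z ∈ S) :
    sysPartition (cut (activeGraph G τ p) x) β γ (hybridFields G β γ lam τ x p S) *
        ∏ w ∈ S, freeMessage G β γ lam τ r x p w true =
      sysPartition (cut (activeGraph G τ p) x) β γ (hybridFields G β γ lam τ x p ∅) *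
        ∏ w ∈ S, freeMessage G β γ lam τ r x p w false := by
  induction S using Finset.induction_on_max with
  | empty => rfl
  | insert w S hlt ih =>
    have hwS : w ∉ S := fun hw => (hlt w hw).ne rfl
    have ih' := ih fun y hy z hz => (Finset.mem_insert.1
      (hS y (Finset.mem_insert_of_mem hy) z hz)).resolve_left (hz.trans (hlt y hy)).ne
    have hmem : ∀ y, y < w → y ∈ S := fun y hy => (Finset.mem_insert.1
      (hS w (Finset.mem_insert_self w S) y hy)).resolve_left hy.ne
    rw [Finset.prod_insert hwS, Finset.prod_insert hwS]
    by_cases hw : (activeGraph G τ p).Adj x w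
    · have hex := (activeGraph_adj_iff h hx hτ w).1 hw
      obtain ⟨ρ, -, hρ⟩ := hch w hex.choose hex.choose_spec
      have e1 := sysPartition_mulField_of_marginalsAgree hex.choose_spec hρ true
      have e2 := sysPartition_mulField_of_marginalsAgree hex.choose_spec hρ false
      have f1 := hybridFields_of_adj (β := β) (γ := γ) (lam := lam) hw (S := S)
        fun y _ => ⟨hlt y, hmem y⟩
      have f2 := hybridFields_of_adj (β := β) (γ := γ) (lam := lam) hw (S := insert w S)
        fun y hy => by simp [hy, show y ∈ S ↔ y < w from ⟨hlt y, hmem y⟩]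
      rw [decide_eq_true hwS] at f1
      rw [show decide (w ∉ insert w S) = false by simp] at f2
      have hm : ∀ s, freeMessage G β γ lam τ r x p w s =
          (sawRooted G τ r).message (sawKernel G β γ lam τ r) ⟨w :: x :: p, hex.choose⟩ s :=
        fun s => by rw [freeMessage, dif_pos hex]
      rw [f1] at ih'
      rw [f2, hm, hm]
      rw [cut_activeGraph] at ih' ⊢
      rw [e1] at ih'
      rw [e2]
      linear_combination ((sawRooted G τ r).message (sawKernel G β γ lam τ r)
        ⟨w :: x :: p, hex.choose⟩ false) * ih'
    · have hm : ∀ s, freeMessage G β γ lam τ r x p w s = 1 := fun s => by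
        rw [freeMessage, dif_neg (mt (activeGraph_adj_iff h hx hτ w).2 hw)]
      rw [hybridFields_insert_of_not_adj hw, hm, hm, one_mul, one_mul, ih']

/-- The field at a free node collects the messages from its pinned children. -/
theorem field_mul_subPartition {x : V} {p : List V} (h : IsSAWNode G τ r (x :: p))
    (hx : x ∉ p) (hτ : τ x = none) (hp : p ≠ []) (t : Bool) :
    field lam t * (sawRooted G τ r).subPartition (sawKernel G β γ lam τ r) ⟨x :: p, h⟩ t =
      nodeFields G β γ lam τ (x :: p) x t * ∏ w, freeMessage G β γ lam τ r x p w t := by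
  classical
  rw [RootedTree.subPartition_eq_prod, prod_children, nodeFields_apply h hx hτ]
  simp only [pinnedFields, hτ]
  rw [mul_assoc, mul_assoc, ← Finset.prod_mul_distrib, ← Finset.prod_mul_distrib]
  congr 1
  refine Finset.prod_congr rfl fun y _ => ?_
  have hiff : IsSAWNode G τ r (y :: x :: p) ↔ G.Adj x y ∧ p.head? ≠ some y := by
    rw [isSAWNode_cons_cons]
    exact ⟨fun h' => h'.2.2.2, fun h' => ⟨h, hx, hτ, h'⟩⟩
  have hfree := h.free_of_mem_tail
  by_cases hxy : G.Adj x y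
  · by_cases hyp : y ∈ p
    · have hτy : τ y = none := hfree y hyp
      have hnf : ¬ ∃ h' : IsSAWNode G τ r (y :: x :: p),
          sawPinning G τ r ⟨y :: x :: p, h'⟩ = none := by
        rintro ⟨h', hc⟩
        rw [sawPinning_cons, if_pos (List.mem_cons_of_mem _ hyp)] at hc
        simp at hc
      simp only [freeMessage, dif_neg hnf, mul_one, if_pos hxy, hτy, pinFactor, one_mul, hyp,
        hxy.symm, true_and]
      by_cases hnext : nextVertex y (x :: p) = x
      · have hno : ¬ IsSAWNode G τ r (y :: x :: p) := by
          rw [hiff]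
          exact fun hc => hc.2 ((nextVertex_eq_iff hyp hx).1 hnext)
        rw [dif_neg hno]
        simp [hnext]
      · have hyes : IsSAWNode G τ r (y :: x :: p) :=
          hiff.2 ⟨hxy, fun hc => hnext ((nextVertex_eq_iff hyp hx).2 hc)⟩
        have hpin : sawPinning G τ r ⟨y :: x :: p, hyes⟩ =
            some (decide (nextVertex y (x :: p) < x)) := by
          rw [sawPinning_cons, if_pos (List.mem_cons_of_mem _ hyp), cycleSpin_eq hyp hxy.ne]
        have hnr : (sawRooted G τ r).par ⟨y :: x :: p, hyes⟩ ≠ sawRoot G τ r := by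
          rw [sawRooted_par_cons]
          intro hc
          have := congrArg Subtype.val hc
          simp only [sawRoot, List.cons.injEq] at this
          exact hp this.2
        rw [dif_pos hyes, message_of_pinned hpin, if_neg hnr, if_pos hnext, interaction_comm]
    · have hyes : IsSAWNode G τ r (y :: x :: p) :=
        hiff.2 ⟨hxy, fun hc => hyp (List.mem_of_mem_head? hc)⟩
      have hpin : sawPinning G τ r ⟨y :: x :: p, hyes⟩ = τ y := by
        rw [sawPinning_cons, if_neg]
        rw [List.mem_cons, not_or]
        exact ⟨hxy.ne', hyp⟩
      simp only [hyp, false_and, if_false, one_mul, if_pos hxy]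
      rw [dif_pos hyes]
      cases hτy : τ y with
      | none =>
        rw [hτy] at hpin
        have hex : ∃ h' : IsSAWNode G τ r (y :: x :: p),
          sawPinning G τ r ⟨y :: x :: p, h'⟩ = none := ⟨hyes, hpin⟩
        simp only [pinFactor, one_mul]
        rw [freeMessage, dif_pos hex]
      | some c =>
        rw [hτy] at hpin
        have hnr : (sawRooted G τ r).par ⟨y :: x :: p, hyes⟩ ≠ sawRoot G τ r := by
          rw [sawRooted_par_cons]
          intro hc
          have := congrArg Subtype.val hc
          simp only [sawRoot, List.cons.injEq] at this
          exact hp this.2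
        have hnf : ¬ ∃ h' : IsSAWNode G τ r (y :: x :: p),
            sawPinning G τ r ⟨y :: x :: p, h'⟩ = none := by
          rintro ⟨h', hc⟩
          rw [hpin] at hc
          simp at hc
        rw [freeMessage, dif_neg hnf, message_of_pinned hpin, if_neg hnr, interaction_comm]
        simp [pinFactor]
  · have hno : ¬ IsSAWNode G τ r (y :: x :: p) := fun hc => hxy (hiff.1 hc).1
    have hnf : ¬ ∃ h' : IsSAWNode G τ r (y :: x :: p),
        sawPinning G τ r ⟨y :: x :: p, h'⟩ = none := fun hc => hno hc.choose
    rw [dif_neg hno, freeMessage, dif_neg hnf]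
    simp [hxy, G.adj_comm y x]

theorem sysPartitionAt_nodeFields (x : V) (p : List V) (t : Bool) :
    sysPartitionAt (activeGraph G τ p) β γ (nodeFields G β γ lam τ (x :: p)) x t =
      nodeFields G β γ lam τ (x :: p) x t * sysPartition (cut (activeGraph G τ p) x) β γ
        (hybridFields G β γ lam τ x p (if t then ∅ else Finset.univ)) := by
  rw [sysPartitionAt_eq, sysPartition_condFields_spin x t true]
  congr 2
  unfold hybridFields
  cases t <;> simp

/-- The marginals at a free node on the graph agree with those on the subtree. -/
theorem marginalsAgree (hβ : 0 ≤ β) (hγ : 0 < γ) (hlam : 0 < lam) (a : SAWNode G τ r) :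
    sawPinning G τ r a = none → ∀ (x : V) (p : List V) (h : IsSAWNode G τ r (x :: p)),
      p ≠ [] → a = ⟨x :: p, h⟩ → MarginalsAgree G β γ lam τ r x p h := by
  induction a using (sawRooted G τ r).leaf_induction with
  | h a ih =>
    rintro ha x p h hp rfl
    rw [sawPinning_cons] at ha
    split_ifs at ha with hx
    have hch : ∀ w (h' : IsSAWNode G τ r (w :: x :: p)),
        sawPinning G τ r ⟨w :: x :: p, h'⟩ = none →
          MarginalsAgree G β γ lam τ r w (x :: p) h' := fun w h' hw =>
      ih ⟨w :: x :: p, h'⟩ (mem_children_iff.2 ⟨w, rfl⟩) hw w (x :: p) h' (by simp) rfl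
    have hK : ∀ s, 0 < ∏ w, freeMessage G β γ lam τ r x p w s := fun s =>
      Finset.prod_pos fun w _ => freeMessage_pos hβ hγ hlam x p w s
    have hZ := (feasibleFields_hybridFields (G := G) (τ := τ) hβ hγ hlam x p ∅).sysPartition_pos
      hβ hγ
    have htel := sysPartition_hybridFields h hx ha hch Finset.univ fun _ _ z _ => Finset.mem_univ z
    refine ⟨sysPartition (cut (activeGraph G τ p) x) β γ (hybridFields G β γ lam τ x p ∅) /
      ∏ w, freeMessage G β γ lam τ r x p w true, div_pos hZ (hK true), fun t => ?_⟩
    rw [field_mul_subPartition h hx ha hp, sysPartitionAt_nodeFields]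
    have h1 := (hK true).ne'
    cases t
    · simp only [Bool.false_eq_true, if_false]
      rw [← eq_div_iff h1] at htel
      rw [htel]
      ring
    · simp only [if_true]
      field_simp

end Weitz

/-! ### The recursive coupling -/

section RecursiveCoupling

variable {V : Type*} [Fintype V] [LinearOrder V] {G : SimpleGraph V} {β γ lam : ℝ}
  {τ : Pinning V} {r : V}

/-- The absolute influence of the root of the self-avoiding-walk tree on the node `a`. -/
noncomputable def rootInfluence (G : SimpleGraph V) (β γ lam : ℝ) (τ : Pinning V) (r : V)
    (a : SAWNode G τ r) : ℝ :=
  |influence (sawTree G τ r) β γ lam (sawPinning G τ r) (sawRoot G τ r) a|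

open Classical in
/-- The sum of the influences of the root on the copies of `u` in the subtree at `b`. -/
noncomputable def descInfluence (G : SimpleGraph V) (β γ lam : ℝ) (τ : Pinning V) (r u : V)
    (b : SAWNode G τ r) : ℝ :=
  ∑ d with d ∈ (sawRooted G τ r).desc b ∧ IsCopy u d, rootInfluence G β γ lam τ r d

theorem rootInfluence_nonneg (a : SAWNode G τ r) : 0 ≤ rootInfluence G β γ lam τ r a :=
  abs_nonneg _

theorem descInfluence_nonneg (u : V) (b : SAWNode G τ r) :
    0 ≤ descInfluence G β γ lam τ r u b :=
  Finset.sum_nonneg fun d _ => rootInfluence_nonneg d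

/-- The conditional law of the system for the walk `x :: p`, given the spin `c` at `x`. -/
noncomputable def nodeLaw (G : SimpleGraph V) (β γ lam : ℝ) (τ : Pinning V) (x : V) (p : List V)
    (c : Bool) : (V → Bool) → ℝ :=
  sysLaw (cut (activeGraph G τ p) x) β γ
    (condFields (activeGraph G τ p) (nodeFields G β γ lam τ (x :: p)) x c
      fun _ => interaction β γ c)

open Classical in
/-- The two conditional laws at the node `a` can be coupled with disagreement probabilities
bounded by influences on the tree. -/
def HasTreeCoupling (G : SimpleGraph V) (β γ lam : ℝ) (τ : Pinning V) (r : V)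
    (a : SAWNode G τ r) : Prop :=
  ∀ (x : V) (p : List V), a.1 = x :: p →
    ∃ f : V → ℝ, CoupledWithin (nodeLaw G β γ lam τ x p false) (nodeLaw G β γ lam τ x p true) f ∧
      ∀ u, u ≠ x → rootInfluence G β γ lam τ r a * f u ≤
        ∑ d with d ∈ (sawRooted G τ r).below a ∧ IsCopy u d, rootInfluence G β γ lam τ r d

theorem feasibleFields_condFields_nodeFields (hβ : 0 ≤ β) (hγ : 0 < γ) (hlam : 0 < lam) (x : V)
    (p : List V) (d c : Bool) : FeasibleFields (cut (activeGraph G τ p) x)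
      (condFields (activeGraph G τ p) (nodeFields G β γ lam τ (x :: p)) x d
        fun _ => interaction β γ c) :=
  (feasibleFields_nodeFields hβ hγ hlam x p).condFields (F := fun _ => interaction β γ c) x d
    (fun _ _ => interaction_nonneg hβ hγ _ _) fun _ => interaction_false_pos hγ _

theorem nodeLaw_nonneg (hβ : 0 ≤ β) (hγ : 0 < γ) (hlam : 0 < lam) (x : V) (p : List V) (c : Bool)
    (σ : V → Bool) : 0 ≤ nodeLaw G β γ lam τ x p c σ :=
  (feasibleFields_condFields_nodeFields hβ hγ hlam x p c c).sysLaw_nonneg hβ hγ σ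

theorem sum_nodeLaw (hβ : 0 ≤ β) (hγ : 0 < γ) (hlam : 0 < lam) (x : V) (p : List V) (c : Bool) :
    ∑ σ, nodeLaw G β γ lam τ x p c σ = 1 :=
  (feasibleFields_condFields_nodeFields hβ hγ hlam x p c c).sum_sysLaw hβ hγ

/-- The probability of `+` at the node `b` given the spin `s` at its parent. -/
noncomputable def childPlusProb (G : SimpleGraph V) (β γ lam : ℝ) (τ : Pinning V) (r : V)
    (b : SAWNode G τ r) (s : Bool) : ℝ :=
  sawKernel G β γ lam τ r b s true *
      (sawRooted G τ r).subPartition (sawKernel G β γ lam τ r) b true /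
    (sawRooted G τ r).message (sawKernel G β γ lam τ r) b s

theorem childPlusProb_nonneg (hβ : 0 ≤ β) (hγ : 0 < γ) (hlam : 0 < lam) {b : SAWNode G τ r}
    (hb : sawPinning G τ r b = none) (s : Bool) : 0 ≤ childPlusProb G β γ lam τ r b s :=
  div_nonneg (mul_nonneg (sawKernel_nonneg hβ hγ hlam _ _ _) (subPartition_nonneg hβ hγ hlam _ _))
    (message_pos hβ hγ hlam hb s).le

theorem one_sub_childPlusProb (hβ : 0 ≤ β) (hγ : 0 < γ) (hlam : 0 < lam) {b : SAWNode G τ r}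
    (hb : sawPinning G τ r b = none) (s : Bool) : 1 - childPlusProb G β γ lam τ r b s =
      sawKernel G β γ lam τ r b s false *
        (sawRooted G τ r).subPartition (sawKernel G β γ lam τ r) b false /
      (sawRooted G τ r).message (sawKernel G β γ lam τ r) b s := by
  have h := (message_pos hβ hγ hlam hb s).ne'
  unfold childPlusProb
  rw [eq_div_iff h, sub_mul, div_mul_cancel₀ _ h, one_mul]
  unfold RootedTree.message
  rw [Fintype.sum_bool]
  ring

theorem childPlusProb_le_one (hβ : 0 ≤ β) (hγ : 0 < γ) (hlam : 0 < lam) {b : SAWNode G τ r}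
    (hb : sawPinning G τ r b = none) (s : Bool) : childPlusProb G β γ lam τ r b s ≤ 1 := by
  rw [← sub_nonneg, one_sub_childPlusProb hβ hγ hlam hb]
  exact div_nonneg (mul_nonneg (sawKernel_nonneg hβ hγ hlam _ _ _)
    (subPartition_nonneg hβ hγ hlam _ _)) (message_pos hβ hγ hlam hb s).le

/-- The system for a child, with the spin at the parent of the child fixed to `s`, is a mixture
of the conditional laws at the child. -/
theorem sysLaw_eq_mix (hβ : 0 ≤ β) (hγ : 0 < γ) (hlam : 0 < lam) {x w : V} {p : List V}
    (h : IsSAWNode G τ r (w :: x :: p)) (hb : sawPinning G τ r ⟨w :: x :: p, h⟩ = none)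
    (s : Bool) :
    sysLaw (activeGraph G τ (x :: p)) β γ
        (mulField (nodeFields G β γ lam τ (w :: x :: p)) w (interaction β γ s)) = fun σ =>
      childPlusProb G β γ lam τ r ⟨w :: x :: p, h⟩ s * nodeLaw G β γ lam τ w (x :: p) true σ +
        (1 - childPlusProb G β γ lam τ r ⟨w :: x :: p, h⟩ s) *
          nodeLaw G β γ lam τ w (x :: p) false σ := by
  funext σ
  obtain ⟨ρ, hρ0, hρ⟩ := marginalsAgree hβ hγ hlam _ hb w (x :: p) h (by simp) rfl
  rw [(feasibleFields_nodeFields hβ hγ hlam w (x :: p)).sysLaw_mulField hβ hγ,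
    ← sysPartition_mulField, sysPartition_mulField_of_marginalsAgree hb hρ, Fintype.sum_bool,
    one_sub_childPlusProb hβ hγ hlam hb]
  have hm := (message_pos hβ hγ hlam hb s).ne'
  unfold childPlusProb nodeLaw
  simp only [hρ, sawKernel_of_none hb]
  congr 2
  · rw [div_eq_div_iff (mul_ne_zero hρ0.ne' hm) hm]
    ring
  · rw [div_eq_div_iff (mul_ne_zero hρ0.ne' hm) hm]
    ring

open Classical in
/-- The coupling of the hybrid systems, obtained by coupling along one neighbour after the
other. -/
theorem exists_coupledWithin_hybrid (hβ : 0 ≤ β) (hγ : 0 < γ) (hlam : 0 < lam) (hr : τ r = none)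
    {x : V} {p : List V} (h : IsSAWNode G τ r (x :: p)) (hx : x ∉ p) (hτ : τ x = none)
    (hch : ∀ w (h' : IsSAWNode G τ r (w :: x :: p)),
      sawPinning G τ r ⟨w :: x :: p, h'⟩ = none →
        HasTreeCoupling G β γ lam τ r ⟨w :: x :: p, h'⟩)
    (S : Finset V) (hS : ∀ y ∈ S, ∀ z, z < y → z ∈ S) :
    ∃ f : V → ℝ, CoupledWithin
        (sysLaw (cut (activeGraph G τ p) x) β γ (hybridFields G β γ lam τ x p S))
        (sysLaw (cut (activeGraph G τ p) x) β γ (hybridFields G β γ lam τ x p ∅)) f ∧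
      ∀ u, rootInfluence G β γ lam τ r ⟨x :: p, h⟩ * f u ≤
        ∑ w ∈ S, if h' : IsSAWNode G τ r (w :: x :: p) then
          descInfluence G β γ lam τ r u ⟨w :: x :: p, h'⟩ else 0 := by
  induction S using Finset.induction_on_max with
  | empty =>
    exact ⟨fun _ => 0, .refl ((feasibleFields_hybridFields hβ hγ hlam x p ∅).sysLaw_nonneg hβ hγ),
      by simp⟩
  | insert w S hlt ih =>
    have hwS : w ∉ S := fun hw => (hlt w hw).ne rfl
    have hmem : ∀ y, y < w → y ∈ S := fun y hy => (Finset.mem_insert.1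
      (hS w (Finset.mem_insert_self w S) y hy)).resolve_left hy.ne
    obtain ⟨f, hf, hfu⟩ := ih fun y hy z hz => (Finset.mem_insert.1
      (hS y (Finset.mem_insert_of_mem hy) z hz)).resolve_left (hz.trans (hlt y hy)).ne
    by_cases hw : (activeGraph G τ p).Adj x w
    · obtain ⟨h', hb⟩ := (activeGraph_adj_iff h hx hτ w).1 hw
      obtain ⟨g, hg, hgu⟩ := hch w h' hb w (x :: p) rfl
      have f1 := hybridFields_of_adj (β := β) (γ := γ) (lam := lam) hw (S := S)
        fun y _ => ⟨hlt y, hmem y⟩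
      have f2 := hybridFields_of_adj (β := β) (γ := γ) (lam := lam) hw (S := insert w S)
        fun y hy => by simp [hy, show y ∈ S ↔ y < w from ⟨hlt y, hmem y⟩]
      rw [decide_eq_true hwS] at f1
      rw [show decide (w ∉ insert w S) = false by simp] at f2
      have hmix := (hg.min_one (sum_nodeLaw hβ hγ hlam w (x :: p) false)).mix
        (nodeLaw_nonneg hβ hγ hlam w (x :: p) false) (nodeLaw_nonneg hβ hγ hlam w (x :: p) true)
        (childPlusProb_nonneg hβ hγ hlam hb false) (childPlusProb_le_one hβ hγ hlam hb false)
        (childPlusProb_nonneg hβ hγ hlam hb true) (childPlusProb_le_one hβ hγ hlam hb true)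
      rw [← sysLaw_eq_mix hβ hγ hlam h' hb, ← sysLaw_eq_mix hβ hγ hlam h' hb, ← f1, ← f2,
        ← cut_activeGraph] at hmix
      refine ⟨_, hmix.trans hf, fun u => ?_⟩
      rw [Finset.sum_insert hwS, dif_pos h', mul_add]
      refine add_le_add ?_ (hfu u)
      have hne : (⟨w :: x :: p, h'⟩ : SAWNode G τ r) ≠ sawRoot G τ r := fun hc => by
        have := congrArg Subtype.val hc
        simp [sawRoot] at this
      have hpsi : rootInfluence G β γ lam τ r ⟨x :: p, h⟩ *
          |childPlusProb G β γ lam τ r ⟨w :: x :: p, h'⟩ false -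
            childPlusProb G β γ lam τ r ⟨w :: x :: p, h'⟩ true| =
          rootInfluence G β γ lam τ r ⟨w :: x :: p, h'⟩ := by
        unfold rootInfluence
        rw [influence_sawTree hβ hγ hlam hr hne hb, abs_mul, sawRooted_par_cons, abs_sub_comm]
        rfl
      rw [← mul_assoc, hpsi]
      by_cases hu : u = w
      · calc _ ≤ rootInfluence G β γ lam τ r ⟨w :: x :: p, h'⟩ * 1 :=
              mul_le_mul_of_nonneg_left (min_le_right _ _) (rootInfluence_nonneg _)
          _ ≤ _ := by
              rw [mul_one]
              unfold descInfluence
              refine Finset.single_le_sum (f := rootInfluence G β γ lam τ r)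
                (fun d _ => rootInfluence_nonneg d) ?_
              simp only [Finset.mem_filter, Finset.mem_univ, true_and]
              exact ⟨RootedTree.self_mem_desc _, by simp [IsCopy, hu]⟩
      · calc _ ≤ rootInfluence G β γ lam τ r ⟨w :: x :: p, h'⟩ * g u :=
              mul_le_mul_of_nonneg_left (min_le_left _ _) (rootInfluence_nonneg _)
          _ ≤ _ := (hgu u hu).trans ?_
        unfold descInfluence
        refine Finset.sum_le_sum_of_subset_of_nonneg ?_ fun d _ _ => rootInfluence_nonneg d
        intro d hd
        simp only [Finset.mem_filter, Finset.mem_univ, true_and] at hd ⊢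
        exact ⟨hd.1.2, hd.2⟩
    · refine ⟨f, ?_, fun u => (hfu u).trans ?_⟩
      · rwa [hybridFields_insert_of_not_adj hw]
      · rw [Finset.sum_insert hwS, le_add_iff_nonneg_left]
        split_ifs
        exacts [descInfluence_nonneg _ _, le_rfl]

open Classical in
theorem sum_descInfluence_le (u : V) (a : SAWNode G τ r) :
    (∑ w, if h' : IsSAWNode G τ r (w :: a.1) then
      descInfluence G β γ lam τ r u ⟨w :: a.1, h'⟩ else 0) ≤
    ∑ d with d ∈ (sawRooted G τ r).below a ∧ IsCopy u d, rootInfluence G β γ lam τ r d := by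
  rw [← sum_children a (descInfluence G β γ lam τ r u)]
  unfold descInfluence
  rw [← Finset.sum_biUnion]
  · refine Finset.sum_le_sum_of_subset_of_nonneg ?_ fun d _ _ => rootInfluence_nonneg d
    intro d hd
    simp only [Finset.mem_biUnion, Finset.mem_filter, Finset.mem_univ, true_and] at hd ⊢
    obtain ⟨b, hb, hd, hu⟩ := hd
    exact ⟨RootedTree.mem_below_of_child hb hd, hu⟩
  · intro b hb b' hb' hne
    simp only [Finset.coe_filter, Finset.mem_univ, true_and, Set.mem_ofPred_eq] at hb hb'
    rw [Function.onFun, Finset.disjoint_left]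
    intro d hd hd'
    simp only [Finset.mem_filter, Finset.mem_univ, true_and] at hd hd'
    exact Set.disjoint_left.1 (RootedTree.disjoint_desc hb hb' hne) hd.1 hd'.1

/-- The recursive coupling exists at every free node. -/
theorem hasTreeCoupling (hβ : 0 ≤ β) (hγ : 0 < γ) (hlam : 0 < lam) (hr : τ r = none)
    (a : SAWNode G τ r) (ha : sawPinning G τ r a = none) : HasTreeCoupling G β γ lam τ r a := by
  induction a using (sawRooted G τ r).leaf_induction with
  | h a ih =>
    obtain ⟨l, hl⟩ := a
    rintro x p (rfl : l = x :: p)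
    rw [sawPinning_cons] at ha
    split_ifs at ha with hx
    obtain ⟨f, hf, hfu⟩ := exists_coupledWithin_hybrid hβ hγ hlam hr hl hx ha
      (fun w h' hw => ih ⟨w :: x :: p, h'⟩ (mem_children_iff.2 ⟨w, rfl⟩) hw) Finset.univ
      fun _ _ z _ => Finset.mem_univ z
    have e1 : sysLaw (cut (activeGraph G τ p) x) β γ (hybridFields G β γ lam τ x p ∅) =
        nodeLaw G β γ lam τ x p true := by simp [nodeLaw, hybridFields]
    have e2 := (feasibleFields_condFields_nodeFields (G := G) (τ := τ) hβ hγ hlam x p false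
      false).coupledWithin_condFields_spin hβ hγ false true
    have e3 : sysLaw (cut (activeGraph G τ p) x) β γ (condFields (activeGraph G τ p)
        (nodeFields G β γ lam τ (x :: p)) x true fun _ => interaction β γ false) =
        sysLaw (cut (activeGraph G τ p) x) β γ (hybridFields G β γ lam τ x p Finset.univ) := by
      simp [hybridFields]
    rw [e3] at e2
    rw [e1] at hf
    refine ⟨_, CoupledWithin.trans e2 hf, fun u hu => ?_⟩
    rw [if_neg hu, zero_add]
    exact (hfu u).trans (sum_descInfluence_le u ⟨x :: p, hl⟩)

end RecursiveCoupling

/-! ### The pinned system as a system with fields -/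

section Pinned

variable {V : Type*} [Fintype V] [DecidableEq V] {G : SimpleGraph V} {β γ lam : ℝ}

theorem weight_eq_sysWeight (ρ : Pinning V) (σ : V → Bool) :
    weight G β γ lam ρ σ =
      sysWeight (activeGraph G ρ []) β γ (pinnedFields G β γ lam ρ) σ := by
  classical
  unfold weight sysWeight
  split_ifs with hag
  · have hprod : ∏ y, pinnedFields G β γ lam ρ y (σ y) =
        (∏ y with ρ y = none, field lam (σ y)) *
          ∏ q : V × V with ρ q.1 = none ∧ G.Adj q.1 q.2 ∧ ρ q.2 ≠ none,
            interaction β γ (σ q.1) (σ q.2) := by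
      rw [Finset.prod_filter, Finset.prod_filter, Fintype.prod_prod_type,
        ← Finset.prod_mul_distrib]
      refine Finset.prod_congr rfl fun y _ => ?_
      unfold pinnedFields
      cases hy : ρ y with
      | none =>
        simp only [if_true]
        congr 1
        refine Finset.prod_congr rfl fun z _ => ?_
        cases hz : ρ z with
        | none => simp [pinFactor]
        | some c => simp [pinFactor, hy, hag z c hz, interaction_comm β γ c]
      | some c => simp [hy, hag y c hy]
    rw [hprod, mul_assoc]
    congr 1
    rw [← Finset.prod_filter_mul_prod_filter_not _
      (fun e : Sym2 V => ∃ x ∈ e, ρ x ≠ none)]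
    congr 1
    · symm
      refine Finset.prod_bij (fun q _ => s(q.1, q.2)) ?_ ?_ ?_ ?_
      · rintro ⟨y, z⟩ hq
        simp only [Finset.mem_filter, Finset.mem_univ, true_and] at hq ⊢
        exact ⟨⟨hq.2.1, y, by simp, hq.1⟩, z, by simp, hq.2.2⟩
      · rintro ⟨y, z⟩ hq ⟨y', z'⟩ hq' heq
        simp only [Finset.mem_filter, Finset.mem_univ, true_and] at hq hq'
        rcases Sym2.eq_iff.1 heq with ⟨h1, h2⟩ | ⟨h1, h2⟩
        · exact Prod.ext h1 h2
        · simp only at h1 h2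
          exact absurd (h1 ▸ hq.1) hq'.2.2
      · intro e he
        simp only [Finset.mem_filter, Finset.mem_univ, true_and] at he
        obtain ⟨⟨he, y, hye, hy⟩, z, hze, hz⟩ := he
        have hyz : y ≠ z := fun h => hz (h ▸ hy)
        obtain rfl := (Sym2.mem_and_mem_iff hyz).1 ⟨hye, hze⟩
        exact ⟨(y, z), by simpa using ⟨hy, he, hz⟩, rfl⟩
      · rintro ⟨y, z⟩ _
        rfl
    · refine Finset.prod_congr ?_ fun _ _ => rfl
      ext e
      simp only [Finset.mem_filter, Finset.mem_univ, true_and]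
      induction e using Sym2.ind with
      | _ y z =>
        simp only [SimpleGraph.mem_edgeSet, activeGraph, Sym2.mem_iff, exists_eq_or_imp,
          exists_eq_left, List.not_mem_nil, not_false_eq_true, true_and]
        tauto
  · unfold Pinning.Agrees at hag
    push Not at hag
    obtain ⟨y, c, hy, hne⟩ := hag
    rw [Finset.prod_eq_zero (Finset.mem_univ y), zero_mul]
    simp [pinnedFields, hy, hne]

theorem gibbs_eq_sysLaw (ρ : Pinning V) :
    gibbs G β γ lam ρ = sysLaw (activeGraph G ρ []) β γ (pinnedFields G β γ lam ρ) := by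
  funext σ
  simp only [gibbs, sysLaw, partition, sysPartition, weight_eq_sysWeight]

omit [Fintype V] in
theorem activeGraph_and {τ : Pinning V} {v : V} (c : Bool) :
    activeGraph G (τ.and v c) [] = cut (activeGraph G τ []) v := by
  have : ∀ y, τ.and v c y = none ↔ y ≠ v ∧ τ y = none := fun y => by
    by_cases hy : y = v <;> simp [Pinning.and, hy]
  ext y z
  simp only [cut, activeGraph, this, List.not_mem_nil, not_false_eq_true, true_and]
  tauto

theorem pinnedFields_and {τ : Pinning V} {v : V} (hv : τ v = none) (c : Bool) :
    pinnedFields G β γ lam (τ.and v c) =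
      condFields (activeGraph G τ []) (pinnedFields G β γ lam τ) v c
        fun _ => interaction β γ c := by
  classical
  funext y s
  unfold condFields
  by_cases hyv : y = v
  · subst hyv
    simp [pinnedFields, Pinning.and]
  · have hρ : τ.and v c y = τ y := Function.update_of_ne hyv _ _
    rw [if_neg hyv]
    unfold pinnedFields
    rw [hρ]
    cases hy : τ y with
    | some d => simp [activeGraph, hy]
    | none =>
      have hadj : (activeGraph G τ []).Adj v y ↔ G.Adj v y := by simp [activeGraph, hy, hv]
      have hterm : ∀ z, (if G.Adj y z then pinFactor β γ (τ.and v c z) s else 1) =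
          (if G.Adj y z then pinFactor β γ (τ z) s else 1) *
            if z = v then (if G.Adj v y then interaction β γ c s else 1) else 1 := fun z => by
        by_cases hz : z = v
        · subst hz
          by_cases ha : G.Adj y z
          · simp [ha, ha.symm, Pinning.and, pinFactor, hv]
          · simp [ha, G.adj_comm z y]
        · simp [Pinning.and, hz]
      rw [Finset.prod_congr rfl fun z _ => hterm z, Finset.prod_mul_distrib,
        Finset.prod_ite_eq', if_pos (Finset.mem_univ _)]
      simp only [hadj]
      split_ifs <;> simp [mul_assoc]

end Pinned

end TwoSpin

theorem mainTheorem8 {V : Type*} [Fintype V] [LinearOrder V] (G : SimpleGraph V)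
    (β γ lam : ℝ) (hβ : 0 ≤ β) (hγ : 0 < γ) (hlam : 0 < lam)
    (τ : TwoSpin.Pinning V) (v : V) (hv : v ∈ τ.free) :
    ∃ J : (τ.free → Bool) → (τ.free → Bool) → ℝ,
      TwoSpin.IsCoupling
        (TwoSpin.marginal (TwoSpin.gibbs G β γ lam (τ.and v false)) τ.free)
        (TwoSpin.marginal (TwoSpin.gibbs G β γ lam (τ.and v true)) τ.free) J ∧
      ∀ u : τ.free, (u : V) ≠ v →
        ∑ X : τ.free → Bool, ∑ Y : τ.free → Bool with X u ≠ Y u, J X Y ≤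
          ∑ a : TwoSpin.SAWNode G τ v with TwoSpin.IsCopy (u : V) a,
            |TwoSpin.influence (TwoSpin.sawTree G τ v) β γ lam (TwoSpin.sawPinning G τ v)
              (TwoSpin.sawRoot G τ v) a| := by
  classical
  have hv' : τ v = none := hv
  obtain ⟨f, hf, hfu⟩ := TwoSpin.hasTreeCoupling hβ hγ hlam hv' (TwoSpin.sawRoot G τ v)
    (TwoSpin.sawPinning_root hv') v [] rfl
  have hlaw : ∀ c, TwoSpin.nodeLaw G β γ lam τ v [] c =
      TwoSpin.gibbs G β γ lam (τ.and v c) := fun c => by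
    rw [TwoSpin.gibbs_eq_sysLaw, TwoSpin.activeGraph_and, TwoSpin.pinnedFields_and hv']
    rfl
  rw [hlaw, hlaw] at hf
  obtain ⟨J, hJ, hJu⟩ := hf.marginal τ.free
  refine ⟨J, by convert hJ, fun u hu => ?_⟩
  have h1 : ∑ X : τ.free → Bool, ∑ Y : τ.free → Bool with X u ≠ Y u, J X Y ≤ f u := by
    convert hJu u
  have h2 := hfu u hu
  rw [TwoSpin.rootInfluence, TwoSpin.influence_self _ hβ hγ hlam, abs_one, one_mul] at h2
  refine h1.trans (h2.trans ?_)
  refine Finset.sum_le_sum_of_subset_of_nonneg ?_ fun a _ _ => abs_nonneg _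
  intro a ha
  simp only [Finset.mem_filter, Finset.mem_univ, true_and] at ha ⊢
  exact ha.2
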